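/- \textbf{Lemma (Cycle finder lemma).} For every $\lambda > 0$ there exist $B, C, \varepsilon > 0$, depending only on $\lambda$, such that the following holds. Let $p = p(n) \in [0,1]$ be any sequence with $p(n) \ge C/n$ for all sufficiently large $n$, and let $G = G(n,p)$ be the binomial random graph on $n$ vertices, in which each edge is present independently with probability $p$. Then, with probability tending to $1$ as $n \to \infty$, the graph $G$ has the following property. For every (not necessarily induced, not necessarily spanning) subgraph $H \subseteq G$ such that \begin{enumerate} \item $|V(H)| > \lambda n$, \item the minimum degree of $H$ satisfies $\delta(H) \geq \lambda n p$, and \item $|E(G[V(H)])| - |E(H)| \leq \varepsilon p n^2$, where $G[V(H)]$ is the subgraph of $G$ induced on $V(H)$, \end{enumerate} the graph $H$ contains a cycle $C_\ell$ of length $\ell$ for every integer $\ell$ with $B \log n \leq \ell \leq |V(H)|$. -/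

import Mathlib

open Filter Topology MeasureTheory
open scoped SimpleGraph

open Classical in
/-- The minimum degree `δ(H)` of a subgraph `H`, as a graph on its own vertex set `V(H)`. -/
noncomputable def subgraphMinDegree {V : Type*} [Fintype V] {G : SimpleGraph V}
    (H : G.Subgraph) : ℕ :=
  H.coe.minDegree

/-!
With high probability `G = G(n, p)` is pseudorandom: disjoint linear sets span a constant fraction
of the expected number of edges (`DenseBetween`), small sets span few edges (`LocallySparse`), and
every sparse subgraph `Γ` of `G` has many edges of `G` among its boosters (`DenseOnSparse`). All
three follow from exponential Markov bounds and union bounds. In the last one the union is over all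
sparse graphs `Γ`, which is affordable because `Γ ⊆ G` has probability only `p ^ e(Γ)`. The rest is
deterministic.

Let `h` be a subgraph with vertex set `W`, minimum degree at least `λ n p`, and few missing edges.
The first two properties pass to `h`: disjoint large subsets of `W` are joined by an edge of `h`,
and small subsets of `W` expand, since a small set with few neighbours would span too many edges.

For lengths `ℓ ≥ β n`, some set of exactly `ℓ` vertices induces in `h` a graph whose minimum degree
is still of order `n p` (`exists_subset_minDegree`), so that it remains to find a Hamiltonian cycle.
Choose a sparse expanding connected spanning subgraph `Γ` (`exists_sparse_expander`). By Pósa's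
rotations a non-Hamiltonian expander has quadratically many boosters, pairs whose addition creates
a Hamiltonian cycle or a longer path (`sq_le_card_longestPathEnds`, `longer_path_of_closing_edge`).
More of them are edges of `G` than `h` misses, so one is an edge of `h`. Adding it to `Γ` and
repeating at most `n` times gives the cycle (`exists_hamiltonian_cycle`). The point of the sparsity
of `Γ` is that `DenseOnSparse` applies at every stage.

For lengths `ℓ` between `B log n` and `β n`, split `W` into an expanding half and its complement.
Depth-first search finds a long path in the complement. Two of its vertices at a suitable distance
have distinct neighbours in the expanding half, from which two disjoint branchings with doubling
layers grow for logarithmically many steps to linear size. An edge between their last layers closes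
a cycle of length exactly `ℓ` (`exists_cycle_of_joined_of_expanding`).
-/

/-! ### Tail bounds and typical properties of the random graph -/

section
open scoped Classical
variable {V : Type*}

/-- The ordered pairs in `A × B` that are adjacent in `G`. -/
noncomputable def adjPairs (G : SimpleGraph V) (A B : Finset V) : Finset (V × V) :=
  (A ×ˢ B).filter fun x => G.Adj x.1 x.2

theorem mem_adjPairs {G : SimpleGraph V} {A B : Finset V} {x : V × V} :
    x ∈ adjPairs G A B ↔ x.1 ∈ A ∧ x.2 ∈ B ∧ G.Adj x.1 x.2 := by
  simp [adjPairs, and_assoc]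

variable [Fintype V]

/-- Graphs on `V` correspond to sets of non-diagonal unordered pairs. -/
theorem sum_edgeFinset_eq_sum_powerset (F : Finset (Sym2 V) → ℝ) :
    ∑ G : SimpleGraph V, F G.edgeFinset =
      ∑ T ∈ (⊤ : SimpleGraph V).edgeFinset.powerset, F T := by
  refine Finset.sum_bij (fun G _ => G.edgeFinset) ?_ ?_ ?_ (fun _ _ => rfl)
  · intro G _
    exact Finset.mem_powerset.2 (SimpleGraph.edgeFinset_mono le_top)
  · intro G _ G' _ h
    exact SimpleGraph.edgeFinset_inj.1 h
  · intro T hT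
    refine ⟨SimpleGraph.fromEdgeSet (T : Set (Sym2 V)), Finset.mem_univ _, ?_⟩
    ext e
    simp only [SimpleGraph.mem_edgeFinset, SimpleGraph.edgeSet_fromEdgeSet, Set.mem_sdiff,
      Finset.mem_coe]
    constructor
    · exact fun h => h.1
    · intro h
      have := Finset.mem_powerset.1 hT h
      rw [SimpleGraph.mem_edgeFinset] at this
      exact ⟨h, by simpa using this⟩

/-- Markov's inequality in `G(V, p)` for a product over all pairs `e` of factors that depend only
on whether `e` is an edge; by independence its expectation is a product. -/
theorem binomialRandom_le_prod (p : unitInterval) (f g : Sym2 V → ℝ)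
    (hf : ∀ e, 0 ≤ f e) (hg : ∀ e, 0 ≤ g e) (S : Set (SimpleGraph V)) {c : ℝ} (hc : 0 < c)
    (hS : ∀ G ∈ S, c ≤ ∏ e ∈ (⊤ : SimpleGraph V).edgeFinset, if e ∈ G.edgeSet then f e else g e) :
    SimpleGraph.binomialRandom V p S ≤
      ENNReal.ofReal ((∏ e ∈ (⊤ : SimpleGraph V).edgeFinset,
        ((p : ℝ) * f e + (1 - (p : ℝ)) * g e)) / c) := by
  have hp0 : (0 : ℝ) ≤ p := p.2.1
  have hp1 : (0 : ℝ) ≤ 1 - (p : ℝ) := sub_nonneg.2 p.2.2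
  set E := (⊤ : SimpleGraph V).edgeFinset with hE
  have hsub : ∀ G : SimpleGraph V, G.edgeFinset ⊆ E := fun G => by
    rw [hE]; exact SimpleGraph.edgeFinset_mono le_top
  have hw : ∀ G : SimpleGraph V, SimpleGraph.binomialRandom V p {G} =
      ENNReal.ofReal ((∏ e ∈ G.edgeFinset, (p : ℝ)) * ∏ e ∈ E \ G.edgeFinset, (1 - (p : ℝ))) := by
    intro G
    rw [SimpleGraph.binomialRandom_singleton]
    have h1 : G.edgeSet.ncard = G.edgeFinset.card := by
      rw [← SimpleGraph.coe_edgeFinset, Set.ncard_coe_finset]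
    have h2 : (Nat.card V).choose 2 - G.edgeSet.ncard = (E \ G.edgeFinset).card := by
      rw [Finset.card_sdiff_of_subset (hsub G), h1, hE,
        SimpleGraph.card_edgeFinset_top_eq_card_choose_two, Nat.card_eq_fintype_card]
    rw [h2, h1, Finset.prod_const, Finset.prod_const, ENNReal.ofReal_mul (by positivity),
      ENNReal.ofReal_pow hp0, ENNReal.ofReal_pow hp1]
    congr 2
    · congr 1
      exact NNReal.eq (by simp [hp0])
    · congr 1
      exact NNReal.eq (by simp [hp1])
  have hprod : ∏ e ∈ E, ((p : ℝ) * f e + (1 - (p : ℝ)) * g e) =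
      ∑ G : SimpleGraph V, ((∏ e ∈ G.edgeFinset, (p : ℝ)) * ∏ e ∈ E \ G.edgeFinset, (1 - (p : ℝ))) *
        ∏ e ∈ E, if e ∈ G.edgeSet then f e else g e := by
    rw [Finset.prod_add, ← sum_edgeFinset_eq_sum_powerset fun T =>
      (∏ e ∈ T, (p : ℝ) * f e) * ∏ e ∈ E \ T, (1 - (p : ℝ)) * g e]
    refine Finset.sum_congr rfl fun G _ => ?_
    have h1 : ∏ e ∈ E, (if e ∈ G.edgeSet then f e else g e) =
        (∏ e ∈ G.edgeFinset, f e) * ∏ e ∈ E \ G.edgeFinset, g e := by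
      rw [← Finset.prod_sdiff (hsub G), mul_comm]
      congr 1
      · refine Finset.prod_congr rfl fun e he => if_pos ?_
        simpa using he
      · refine Finset.prod_congr rfl fun e he => if_neg ?_
        simpa using (Finset.mem_sdiff.1 he).2
    rw [h1, Finset.prod_mul_distrib, Finset.prod_mul_distrib]
    ring
  have hfin : SimpleGraph.binomialRandom V p S ≤
      ∑ G ∈ S.toFinset, SimpleGraph.binomialRandom V p {G} := by
    refine le_trans (measure_mono ?_) (measure_biUnion_finset_le S.toFinset fun G => {G})
    intro G hG
    simpa using hG
  refine hfin.trans ?_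
  rw [hprod]
  simp_rw [hw]
  rw [← ENNReal.ofReal_sum_of_nonneg (fun G _ => by positivity)]
  apply ENNReal.ofReal_le_ofReal
  have hX : ∀ G : SimpleGraph V, 0 ≤ ∏ e ∈ E, if e ∈ G.edgeSet then f e else g e := fun G =>
    Finset.prod_nonneg fun e _ => by split_ifs <;> simp [hf, hg]
  rw [le_div_iff₀ hc, Finset.sum_mul]
  calc _ ≤ ∑ G ∈ S.toFinset, ((∏ e ∈ G.edgeFinset, (p : ℝ)) *
          ∏ e ∈ E \ G.edgeFinset, (1 - (p : ℝ))) *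
          ∏ e ∈ E, if e ∈ G.edgeSet then f e else g e := by
        refine Finset.sum_le_sum fun G hG => ?_
        exact mul_le_mul_of_nonneg_left (hS G (by simpa using hG)) (by positivity)
    _ ≤ _ := Finset.sum_le_sum_of_subset_of_nonneg (Finset.subset_univ _) fun G _ _ =>
        mul_nonneg (by positivity) (hX G)

/-- The edges of `G` lying in a given set of unordered pairs. -/
noncomputable def edgesIn (G : SimpleGraph V) (B : Finset (Sym2 V)) : Finset (Sym2 V) :=
  B.filter (· ∈ G.edgeSet)

/-- The event that `F` consists of edges is independent of the number of edges in `B`, so its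
probability `p ^ |F|` is a factor of the exponential Markov bound. -/
theorem binomialRandom_edgesIn_le (p : unitInterval) (F B : Finset (Sym2 V))
    (hF : F ⊆ (⊤ : SimpleGraph V).edgeFinset) (hB : B ⊆ (⊤ : SimpleGraph V).edgeFinset)
    (hFB : Disjoint F B) {y c : ℝ} (hy : 0 < y) (hc : 0 < c) :
    SimpleGraph.binomialRandom V p
      {G | (F : Set (Sym2 V)) ⊆ G.edgeSet ∧ c ≤ y ^ (edgesIn G B).card} ≤
      ENNReal.ofReal ((p : ℝ) ^ F.card * (Real.exp ((p : ℝ) * (y - 1) * B.card) / c)) := by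
  set E := (⊤ : SimpleGraph V).edgeFinset with hE
  have hp0 : (0 : ℝ) ≤ p := p.2.1
  have hp1 : (0 : ℝ) ≤ 1 - (p : ℝ) := sub_nonneg.2 p.2.2
  have hbase : SimpleGraph.binomialRandom V p
      {G | (F : Set (Sym2 V)) ⊆ G.edgeSet ∧ c ≤ y ^ (edgesIn G B).card} ≤
      ENNReal.ofReal ((p : ℝ) ^ F.card * (1 + (p : ℝ) * (y - 1)) ^ B.card / c) := by
    have key := binomialRandom_le_prod p (fun e => if e ∈ B then y else 1)
      (fun e => if e ∈ F then 0 else 1) (fun e => by split_ifs <;> positivity)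
      (fun e => by split_ifs <;> positivity)
      {G | (F : Set (Sym2 V)) ⊆ G.edgeSet ∧ c ≤ y ^ (edgesIn G B).card} hc ?_
    · refine key.trans (ENNReal.ofReal_le_ofReal (le_of_eq ?_))
      congr 1
      have h1 : ∀ e, ((p : ℝ) * (if e ∈ B then y else 1) + (1 - (p : ℝ)) * (if e ∈ F then 0 else 1)) =
          (if e ∈ F then (p : ℝ) else 1) * (if e ∈ B then (1 + (p : ℝ) * (y - 1)) else 1) := by
        intro e
        by_cases h : e ∈ F
        · simp [h, Finset.disjoint_left.1 hFB h]
        · by_cases h' : e ∈ B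
          · simp [h, h']; ring
          · simp [h, h']
      simp_rw [h1]
      rw [Finset.prod_mul_distrib, Finset.prod_ite_mem, Finset.prod_ite_mem,
        Finset.inter_eq_right.2 hF, Finset.inter_eq_right.2 hB, Finset.prod_const,
        Finset.prod_const]
    · rintro G ⟨hG, hcG⟩
      refine hcG.trans (le_of_eq ?_)
      have h1 : ∀ e ∈ E, (if e ∈ G.edgeSet then (if e ∈ B then y else 1) else
          (if e ∈ F then (0 : ℝ) else 1)) = if e ∈ edgesIn G B then y else 1 := by
        intro e _
        by_cases h : e ∈ G.edgeSet
        · simp [h, edgesIn]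
        · have : e ∉ F := fun h' => h (hG h')
          simp [h, edgesIn, this]
      rw [Finset.prod_congr rfl h1, Finset.prod_ite_mem, Finset.inter_eq_right.2
        (show edgesIn G B ⊆ E from (Finset.filter_subset _ _).trans hB), Finset.prod_const]
  refine hbase.trans ?_
  apply ENNReal.ofReal_le_ofReal
  have h1 : (1 + (p : ℝ) * (y - 1)) ^ B.card ≤ Real.exp ((p : ℝ) * (y - 1) * B.card) := by
    rw [mul_comm _ (B.card : ℝ), Real.exp_nat_mul]
    gcongr
    · nlinarith
    · linarith [Real.add_one_le_exp ((p : ℝ) * (y - 1))]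
  calc _ = (p : ℝ) ^ F.card * ((1 + (p : ℝ) * (y - 1)) ^ B.card / c) := by
        field_simp
    _ ≤ _ := by gcongr

theorem binomialRandom_lower_tail (p : unitInterval) (F B : Finset (Sym2 V))
    (hF : F ⊆ (⊤ : SimpleGraph V).edgeFinset) (hB : B ⊆ (⊤ : SimpleGraph V).edgeFinset)
    (hFB : Disjoint F B) :
    SimpleGraph.binomialRandom V p
      {G | (F : Set (Sym2 V)) ⊆ G.edgeSet ∧ ((edgesIn G B).card : ℝ) < (p : ℝ) * B.card / 4} ≤
      ENNReal.ofReal ((p : ℝ) ^ F.card * Real.exp (-((p : ℝ) * B.card / 4))) := by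
  have key := binomialRandom_edgesIn_le p F B hF hB hFB (y := 1 / 2)
    (c := Real.exp (-((p : ℝ) * B.card / 4))) (by norm_num) (Real.exp_pos _)
  refine (measure_mono ?_).trans (key.trans (ENNReal.ofReal_le_ofReal (le_of_eq ?_)))
  · rintro G ⟨hG, h⟩
    refine ⟨hG, ?_⟩
    have h2 : (1 / 2 : ℝ) = Real.exp (-Real.log 2) := by
      rw [Real.exp_neg, Real.exp_log (by norm_num)]; norm_num
    rw [h2, ← Real.exp_nat_mul]
    apply Real.exp_le_exp.2
    have h3 : Real.log 2 ≤ 1 := by linarith [Real.log_two_lt_d9]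
    nlinarith [mul_nonneg (Nat.cast_nonneg (α := ℝ) (edgesIn G B).card) (sub_nonneg.2 h3)]
  · rw [← Real.exp_sub]
    ring_nf

theorem binomialRandom_upper_tail (p : unitInterval) (B : Finset (Sym2 V))
    (hB : B ⊆ (⊤ : SimpleGraph V).edgeFinset) {y : ℝ} (hy : 1 ≤ y) (m : ℝ) :
    SimpleGraph.binomialRandom V p {G | m ≤ ((edgesIn G B).card : ℝ)} ≤
      ENNReal.ofReal (Real.exp ((p : ℝ) * (y - 1) * B.card - m * Real.log y)) := by
  have key := binomialRandom_edgesIn_le p ∅ B (Finset.empty_subset _) hB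
    (Finset.disjoint_empty_left _) (y := y) (c := Real.exp (m * Real.log y)) (by linarith)
    (Real.exp_pos _)
  refine (measure_mono ?_).trans (key.trans (ENNReal.ofReal_le_ofReal (le_of_eq ?_)))
  · intro G h
    refine ⟨by simp, ?_⟩
    rw [← Real.exp_log (show 0 < y ^ (edgesIn G B).card by positivity), Real.log_pow]
    exact Real.exp_le_exp.2 (mul_le_mul_of_nonneg_right h (Real.log_nonneg hy))
  · rw [← Real.exp_sub]
    simp

/-- Any two disjoint sets of at least `δ n` vertices span a positive fraction of the expected
number of edges. -/
def DenseBetween (G : SimpleGraph V) (p δ : ℝ) : Prop :=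
  ∀ A B : Finset V, Disjoint A B → δ * Fintype.card V ≤ A.card → δ * Fintype.card V ≤ B.card →
    p * A.card * B.card / 4 ≤ (adjPairs G A B).card

/-- Any set `S` of at most `γ n` vertices spans at most `θ n p |S|` edges, each of which is counted
twice in `adjPairs G S S`. -/
def LocallySparse (G : SimpleGraph V) (p θ γ : ℝ) : Prop :=
  ∀ S : Finset V, (S.card : ℝ) ≤ γ * Fintype.card V →
    ((adjPairs G S S).card : ℝ) ≤ 2 * θ * Fintype.card V * p * S.card

theorem measure_exists_le {Ω ι : Type*} [MeasurableSpace Ω] (μ : Measure Ω) (s : Finset ι)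
    (P : ι → Set Ω) (b : ι → ℝ) (hb : ∀ i ∈ s, 0 ≤ b i)
    (h : ∀ i ∈ s, μ (P i) ≤ ENNReal.ofReal (b i)) :
    μ {ω | ∃ i ∈ s, ω ∈ P i} ≤ ENNReal.ofReal (∑ i ∈ s, b i) := by
  rw [ENNReal.ofReal_sum_of_nonneg hb]
  have : {ω | ∃ i ∈ s, ω ∈ P i} = ⋃ i ∈ s, P i := by ext; simp
  rw [this]
  exact (measure_biUnion_finset_le s P).trans (Finset.sum_le_sum h)

theorem exp_neg_le_one_div {x : ℝ} (hx : 0 < x) : Real.exp (-x) ≤ 1 / x := by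
  rw [Real.exp_neg, ← one_div]
  exact one_div_le_one_div_of_le hx (by linarith [Real.add_one_le_exp x])

theorem four_pow_le_exp (n : ℕ) : (4 : ℝ) ^ n ≤ Real.exp (2 * n) := by
  rw [mul_comm, Real.exp_nat_mul]
  have : (4 : ℝ) ≤ Real.exp 2 := by
    have := Real.exp_one_gt_d9
    have h : Real.exp 2 = Real.exp 1 * Real.exp 1 := by rw [← Real.exp_add]; norm_num
    rw [h]; nlinarith
  gcongr

theorem measure_not_denseBetween_le [Nonempty V] (p : unitInterval) {δ : ℝ} (hδ : 0 < δ)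
    (hp : 12 / δ ^ 2 ≤ p * Fintype.card V) :
    SimpleGraph.binomialRandom V p {G | ¬ DenseBetween G p δ} ≤
      ENNReal.ofReal (1 / Fintype.card V) := by
  have hn : (0 : ℝ) < Fintype.card V := by exact_mod_cast Fintype.card_pos
  have hp0 : (0 : ℝ) ≤ p := p.2.1
  set n : ℝ := ((Fintype.card V : ℕ) : ℝ) with hnd
  set s : Finset (Finset V × Finset V) := Finset.univ.filter fun x =>
    Disjoint x.1 x.2 ∧ δ * n ≤ x.1.card ∧ δ * n ≤ x.2.card with hs
  let Bs : Finset V × Finset V → Finset (Sym2 V) := fun x =>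
    (x.1 ×ˢ x.2).image fun y => s(y.1, y.2)
  have hinj : ∀ x ∈ s, Set.InjOn (fun y : V × V => s(y.1, y.2)) (x.1 ×ˢ x.2 : Finset (V × V)) := by
    rintro ⟨A, B⟩ hx ⟨a, b⟩ hab ⟨a', b'⟩ hab' h
    have hd : Disjoint A B := (Finset.mem_filter.1 hx).2.1
    simp only [Finset.coe_product, Set.mem_prod, Finset.mem_coe] at hab hab'
    rcases Sym2.eq_iff.1 h with ⟨h1, h2⟩ | ⟨h1, h2⟩
    · simp_all
    · exact absurd hab'.2 (Finset.disjoint_left.1 hd ((show a = b' from h1) ▸ hab.1))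
  have hcard : ∀ x ∈ s, ((Bs x).card : ℝ) = x.1.card * x.2.card := by
    intro x hx
    simp only [Bs]
    rw [Finset.card_image_of_injOn (hinj x hx), Finset.card_product]
    push_cast; rfl
  have hedge : ∀ x ∈ s, ∀ G : SimpleGraph V,
      (edgesIn G (Bs x)).card ≤ (adjPairs G x.1 x.2).card := by
    intro x hx G
    have : edgesIn G (Bs x) ⊆ (adjPairs G x.1 x.2).image fun y => s(y.1, y.2) := by
      intro e he
      obtain ⟨h1, h2⟩ := Finset.mem_filter.1 he
      obtain ⟨y, hy, rfl⟩ := Finset.mem_image.1 h1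
      exact Finset.mem_image.2 ⟨y, Finset.mem_filter.2 ⟨hy, h2⟩, rfl⟩
    exact (Finset.card_le_card this).trans Finset.card_image_le
  have hBE : ∀ x ∈ s, Bs x ⊆ (⊤ : SimpleGraph V).edgeFinset := by
    intro x hx e he
    obtain ⟨y, hy, rfl⟩ := Finset.mem_image.1 he
    have hd : Disjoint x.1 x.2 := (Finset.mem_filter.1 hx).2.1
    simp only [SimpleGraph.mem_edgeFinset, SimpleGraph.mem_edgeSet, SimpleGraph.top_adj]
    intro h
    have := Finset.mem_product.1 hy
    exact Finset.disjoint_left.1 hd this.1 (h ▸ this.2)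
  have key := measure_exists_le (SimpleGraph.binomialRandom V p) s
    (fun x => {G | ((∅ : Finset (Sym2 V)) : Set (Sym2 V)) ⊆ G.edgeSet ∧
      ((edgesIn G (Bs x)).card : ℝ) < (p : ℝ) * (Bs x).card / 4})
    (fun x => Real.exp (-(3 * n))) (fun x _ => (Real.exp_pos _).le) ?_
  · refine (measure_mono ?_).trans (key.trans (ENNReal.ofReal_le_ofReal ?_))
    · intro G hG
      simp only [DenseBetween, Set.mem_ofPred_eq, not_forall, not_le] at hG
      obtain ⟨A, B, hd, hA, hB, h⟩ := hG
      have hx : (A, B) ∈ s := Finset.mem_filter.2 ⟨Finset.mem_univ _, hd, hA, hB⟩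
      refine ⟨(A, B), hx, by simp, ?_⟩
      rw [hcard _ hx]
      have : ((edgesIn G (Bs (A, B))).card : ℝ) ≤ (adjPairs G A B).card := by
        exact_mod_cast hedge _ hx G
      simp only
      linarith [mul_assoc (p : ℝ) A.card B.card]
    · rw [Finset.sum_const, nsmul_eq_mul]
      have h1 : (s.card : ℝ) ≤ 4 ^ Fintype.card V := by
        have : s.card ≤ 4 ^ Fintype.card V := by
          refine (Finset.card_le_univ s).trans (le_of_eq ?_)
          rw [Fintype.card_prod, Fintype.card_finset, ← mul_pow]
          norm_num
        exact_mod_cast this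
      have h2 : (4 : ℝ) ^ Fintype.card V ≤ Real.exp (2 * n) := four_pow_le_exp _
      calc (s.card : ℝ) * Real.exp (-(3 * n)) ≤ Real.exp (2 * n) * Real.exp (-(3 * n)) := by
            gcongr; exact h1.trans h2
        _ = Real.exp (-n) := by rw [← Real.exp_add]; ring_nf
        _ ≤ _ := exp_neg_le_one_div hn
  · intro x hx
    refine (binomialRandom_lower_tail p ∅ (Bs x) (Finset.empty_subset _) (hBE x hx)
      (Finset.disjoint_empty_left _)).trans (ENNReal.ofReal_le_ofReal ?_)
    simp only [Finset.card_empty, pow_zero, one_mul]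
    apply Real.exp_le_exp.2
    rw [hcard x hx, neg_le_neg_iff]
    obtain ⟨_, hA, hB⟩ := (Finset.mem_filter.1 hx).2
    have h1 : δ * n * (δ * n) ≤ (x.1.card : ℝ) * x.2.card := by gcongr
    have h2 : 12 ≤ p * n * δ ^ 2 := by
      rwa [div_le_iff₀ (by positivity)] at hp
    calc 3 * n = 12 * n / 4 := by ring
      _ ≤ (p * n * δ ^ 2) * n / 4 := by gcongr
      _ = (p : ℝ) * (δ * n * (δ * n)) / 4 := by ring
      _ ≤ _ := by gcongr

theorem measure_adjPairs_self_gt_le (p : unitInterval) (S : Finset V) {y : ℝ} (hy : 1 ≤ y)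
    (m : ℝ) :
    SimpleGraph.binomialRandom V p {G | 2 * m < ((adjPairs G S S).card : ℝ)} ≤
      ENNReal.ofReal (Real.exp ((p : ℝ) * y * S.card ^ 2 - m * Real.log y)) := by
  have hp0 : (0 : ℝ) ≤ p := p.2.1
  set B : Finset (Sym2 V) := S.offDiag.image fun y => s(y.1, y.2) with hBd
  have hB : B ⊆ (⊤ : SimpleGraph V).edgeFinset := by
    intro e he
    obtain ⟨y, hy, rfl⟩ := Finset.mem_image.1 he
    simpa using (Finset.mem_offDiag.1 hy).2.2
  refine (measure_mono ?_).trans ((binomialRandom_upper_tail p B hB hy m).trans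
    (ENNReal.ofReal_le_ofReal (Real.exp_le_exp.2 ?_)))
  · intro G hG
    have h1 : (adjPairs G S S).card ≤ 2 * (edgesIn G B).card := by
      refine Finset.card_le_mul_card_image_of_maps_to (f := fun y : V × V => s(y.1, y.2)) ?_ 2 ?_
      · intro y hy
        obtain ⟨h1, h2, h3⟩ := mem_adjPairs.1 hy
        exact Finset.mem_filter.2 ⟨Finset.mem_image.2
          ⟨y, Finset.mem_offDiag.2 ⟨h1, h2, h3.ne⟩, rfl⟩, h3⟩
      · intro e _
        induction e using Sym2.ind with
        | _ a b =>
          refine (Finset.card_le_card (t := {(a, b), (b, a)}) ?_).trans Finset.card_le_two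
          rintro ⟨c, d⟩ h
          have := (Finset.mem_filter.1 h).2
          simpa using this
    have h2 : ((adjPairs G S S).card : ℝ) ≤ 2 * (edgesIn G B).card := by exact_mod_cast h1
    have hG' : 2 * m < ((adjPairs G S S).card : ℝ) := hG
    change m ≤ ((edgesIn G B).card : ℝ)
    linarith
  · have h1 : (B.card : ℝ) ≤ S.card ^ 2 := by
      have : B.card ≤ S.card ^ 2 := by
        refine Finset.card_image_le.trans ?_
        rw [Finset.offDiag_card, sq]; exact Nat.sub_le _ _
      exact_mod_cast this
    have : (p : ℝ) * (y - 1) * B.card ≤ p * y * S.card ^ 2 := by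
      gcongr
      linarith
    linarith

theorem measure_adjPairs_univ_gt_le [Nonempty V] (p : unitInterval)
    (hp : 1 ≤ p * (Fintype.card V : ℝ)) :
    SimpleGraph.binomialRandom V p {G | 12 * (p : ℝ) * (Fintype.card V : ℝ) ^ 2 <
      ((adjPairs G Finset.univ Finset.univ).card : ℝ)} ≤ ENNReal.ofReal (1 / Fintype.card V) := by
  have hn : (0 : ℝ) < Fintype.card V := by exact_mod_cast Fintype.card_pos
  have key := measure_adjPairs_self_gt_le p (Finset.univ : Finset V) (y := 2) (by norm_num)
    (6 * (p : ℝ) * (Fintype.card V : ℝ) ^ 2)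
  refine (measure_mono ?_).trans (key.trans (ENNReal.ofReal_le_ofReal ?_))
  · intro G hG
    have hG' : 12 * (p : ℝ) * (Fintype.card V : ℝ) ^ 2 <
      ((adjPairs G Finset.univ Finset.univ).card : ℝ) := hG
    have : 2 * (6 * (p : ℝ) * (Fintype.card V : ℝ) ^ 2) <
      ((adjPairs G Finset.univ Finset.univ).card : ℝ) := by linarith
    exact this
  · refine le_trans (Real.exp_le_exp.2 ?_) (exp_neg_le_one_div hn)
    rw [Finset.card_univ]
    have h2 := Real.log_two_gt_d9
    have h3 : (Fintype.card V : ℝ) ≤ p * (Fintype.card V : ℝ) ^ 2 := by nlinarith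
    nlinarith

/-- The contribution of the sets of size `s` to the union bound over small sets. -/
theorem choose_mul_pow_le {n s : ℕ} (hs : 0 < s) (h : 3 * (s : ℝ) ≤ n) :
    (n.choose s : ℝ) * ((s : ℝ) / n) ^ (4 * s) ≤ 1 / (n : ℝ) ^ 2 := by
  have hs' : (0 : ℝ) < s := by exact_mod_cast hs
  have hn : (0 : ℝ) < n := by linarith
  set x : ℝ := (s : ℝ) / n with hx
  have hx0 : 0 < x := by positivity
  have hx3 : x ≤ 1 / 3 := by rw [hx, div_le_div_iff₀ hn (by norm_num)]; linarith
  -- `x ^ s ≤ 1 / n`, as `(n / s) ^ s ≥ (n / s) * 2 ^ (s - 1) ≥ n`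
  have h1 : x ^ s ≤ 1 / n := by
    obtain ⟨k, rfl⟩ : ∃ k, s = k + 1 := ⟨s - 1, by omega⟩
    have h2 : ((k + 1 : ℕ) : ℝ) ≤ 2 ^ k := by exact_mod_cast Nat.lt_two_pow_self (n := k)
    calc x ^ (k + 1) = x ^ k * x := pow_succ _ _
      _ ≤ (1 / 2) ^ k * x := by gcongr; linarith
      _ = (((k + 1 : ℕ) : ℝ) / 2 ^ k) / n := by rw [hx, div_pow, one_pow]; field_simp
      _ ≤ 1 / n := by gcongr; rw [div_le_one (by positivity)]; exact h2
  have h2 : (n.choose s : ℝ) * x ^ s ≤ Real.exp s := by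
    calc (n.choose s : ℝ) * x ^ s ≤ (n : ℝ) ^ s / s.factorial * x ^ s := by
          gcongr; exact Nat.choose_le_pow_div s n
      _ = (s : ℝ) ^ s / s.factorial := by rw [hx, div_pow]; field_simp
      _ ≤ Real.exp s := Real.pow_div_factorial_le_exp _ hs'.le s
  have h3 : Real.exp s * x ^ s ≤ 1 := by
    have : Real.exp s = Real.exp 1 ^ s := by rw [← Real.exp_nat_mul, mul_one]
    rw [this, ← mul_pow]
    refine pow_le_one₀ (by positivity) ?_
    nlinarith [Real.exp_one_lt_d9, Real.exp_pos 1]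
  calc (n.choose s : ℝ) * x ^ (4 * s) = (n.choose s : ℝ) * x ^ s * x ^ s * (x ^ s * x ^ s) := by
        rw [mul_comm 4 s, pow_mul]; ring
    _ ≤ Real.exp s * x ^ s * (1 / n * (1 / n)) := by gcongr
    _ ≤ 1 * (1 / n * (1 / n)) := by gcongr
    _ = _ := by field_simp

/-- Union bound over all small vertex sets `S`: the upper tail with `y = θ n / |S|` gives each of
them probability at most `(|S| / n) ^ (4 |S|)`. -/
theorem measure_not_locallySparse_le [Nonempty V] (p : unitInterval) {θ : ℝ} (hθ : 0 < θ)
    (hθ1 : θ ≤ 1) (hp : 8 / θ ≤ p * (Fintype.card V : ℝ)) :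
    SimpleGraph.binomialRandom V p {G | ¬ LocallySparse G p θ (θ ^ 2 / 9)} ≤
      ENNReal.ofReal (1 / Fintype.card V) := by
  have hn : (0 : ℝ) < Fintype.card V := by exact_mod_cast Fintype.card_pos
  have hp0 : (0 : ℝ) ≤ p := p.2.1
  set n : ℝ := ((Fintype.card V : ℕ) : ℝ) with hnd
  set t : Finset (Finset V) := Finset.univ.filter fun S => 0 < S.card ∧
    (S.card : ℝ) ≤ θ ^ 2 / 9 * n with ht
  have key := measure_exists_le (SimpleGraph.binomialRandom V p) t
    (fun S => {G | 2 * (θ * n * p * S.card) < ((adjPairs G S S).card : ℝ)})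
    (fun S => ((S.card : ℝ) / n) ^ (4 * S.card)) (fun x _ => by positivity) ?_
  · refine (measure_mono ?_).trans (key.trans (ENNReal.ofReal_le_ofReal ?_))
    · intro G hG
      simp only [LocallySparse, Set.mem_ofPred_eq, not_forall, not_le] at hG
      obtain ⟨S, hS, h⟩ := hG
      have hS0 : 0 < S.card := by
        rcases Finset.eq_empty_or_nonempty S with rfl | h'
        · simp [adjPairs] at h
        · exact h'.card_pos
      refine ⟨S, Finset.mem_filter.2 ⟨Finset.mem_univ _, hS0, hS⟩, ?_⟩
      have : 2 * (θ * n * p * S.card) < ((adjPairs G S S).card : ℝ) := by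
        rw [← hnd] at h; linarith
      exact this
    · let w : ℕ → ℝ := fun k => if 0 < k ∧ (k : ℝ) ≤ θ ^ 2 / 9 * n then ((k : ℝ) / n) ^ (4 * k) else 0
      have h1 : ∑ S ∈ t, ((S.card : ℝ) / n) ^ (4 * S.card) =
          ∑ S ∈ (Finset.univ : Finset V).powerset, w S.card := by
        rw [ht, Finset.sum_filter, Finset.powerset_univ]
      rw [h1, Finset.sum_powerset_apply_card]
      have h2 : ∀ k ∈ Finset.range ((Finset.univ : Finset V).card + 1),
          (Finset.univ : Finset V).card.choose k • w k ≤ if k = 0 then 0 else 1 / n ^ 2 := by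
        intro k _
        rw [nsmul_eq_mul, Finset.card_univ]
        by_cases hk : 0 < k ∧ (k : ℝ) ≤ θ ^ 2 / 9 * n
        · simp only [w, if_pos hk, if_neg hk.1.ne']
          refine choose_mul_pow_le hk.1 ?_
          have : θ ^ 2 ≤ 1 := by nlinarith
          nlinarith [hk.2]
        · simp only [w, if_neg hk, mul_zero]
          split_ifs <;> positivity
      refine (Finset.sum_le_sum h2).trans (le_of_eq ?_)
      rw [Finset.sum_range_succ']
      simp only [Nat.add_eq_zero_iff, one_ne_zero, and_false, if_false, if_true, add_zero,
        Finset.sum_const, Finset.card_range, nsmul_eq_mul, Finset.card_univ]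
      rw [← hnd]; field_simp
  · intro S hS
    obtain ⟨hS0, hS⟩ := (Finset.mem_filter.1 hS).2
    have hs : (0 : ℝ) < S.card := by exact_mod_cast hS0
    have hy : 1 ≤ θ * n / S.card := by
      rw [le_div_iff₀ hs]
      nlinarith [mul_nonneg (sub_nonneg.2 hθ1) (mul_nonneg hn.le hθ.le), mul_pos hn hθ]
    refine (measure_adjPairs_self_gt_le p S hy _).trans (ENNReal.ofReal_le_ofReal ?_)
    have hx : (S.card : ℝ) / n = Real.exp (-Real.log (n / S.card)) := by
      rw [Real.exp_neg, Real.exp_log (by positivity), inv_div]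
    rw [hx, ← Real.exp_nat_mul]
    apply Real.exp_le_exp.2
    set Lg := Real.log (n / S.card) with hL
    have hlog : Real.log (θ * n / S.card) = Lg + Real.log θ := by
      rw [hL, ← Real.log_mul (by positivity) (by positivity)]
      congr 1; ring
    have h9 : 2 ≤ Real.log 9 := by
      rw [Real.le_log_iff_exp_le (by norm_num)]
      have h : Real.exp 2 = Real.exp 1 * Real.exp 1 := by rw [← Real.exp_add]; norm_num
      rw [h]; nlinarith [Real.exp_one_lt_d9, Real.exp_pos 1]
    have hLge : 2 - 2 * Real.log θ ≤ Lg := by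
      have h1 : 9 / θ ^ 2 ≤ n / S.card := by
        rw [div_le_div_iff₀ (by positivity) hs]; linarith
      have h2 := Real.log_le_log (by positivity) h1
      rw [Real.log_div (by norm_num) (by positivity), Real.log_pow] at h2
      push_cast at h2
      linarith
    have hθn : 8 ≤ θ * n * p := by
      rw [div_le_iff₀ hθ] at hp; linarith
    have hlogθ : Real.log θ ≤ 0 := Real.log_nonpos hθ.le hθ1
    have e1 : (p : ℝ) * (θ * n / S.card) * S.card ^ 2 = θ * n * p * S.card := by
      field_simp
    rw [e1, hlog]
    push_cast
    have h3 : 8 * (S.card : ℝ) * (Lg / 2) ≤ θ * n * p * S.card * (Lg / 2) := by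
      gcongr
      linarith
    have h4 : θ * n * p * S.card * (Lg / 2) ≤ θ * n * p * S.card * (Lg + Real.log θ - 1) := by
      gcongr
      linarith
    linarith

/-- Every sparse subgraph `Γ` of `G` for which `B Γ` is a quadratically large set of pairs has a
positive proportion of the expected number of edges of `G` in `B Γ`. -/
def DenseOnSparse (G : SimpleGraph V) (p η κ : ℝ) (B : SimpleGraph V → Finset (Sym2 V)) : Prop :=
  ∀ Γ ≤ G, (Γ.edgeFinset.card : ℝ) ≤ η * p * (Fintype.card V : ℝ) ^ 2 →
    κ * (Fintype.card V : ℝ) ^ 2 ≤ (B Γ).card →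
    κ * p * (Fintype.card V : ℝ) ^ 2 / 4 ≤ (edgesIn G (B Γ)).card

theorem sum_pow_card_edgeFinset (a : ℝ) :
    ∑ Γ : SimpleGraph V, a ^ Γ.edgeFinset.card =
      (a + 1) ^ (⊤ : SimpleGraph V).edgeFinset.card := by
  have h := Finset.sum_pow_mul_eq_add_pow a 1 (⊤ : SimpleGraph V).edgeFinset
  simp only [one_pow, mul_one] at h
  rw [← h]
  exact sum_edgeFinset_eq_sum_powerset fun T => a ^ T.card

/-- Union bound over all pairs `Γ, B Γ`. It is affordable since `Γ` is itself required to be a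
subgraph of `G`, an event of probability `p ^ e(Γ)`, independent of the edges in `B Γ`. -/
theorem measure_not_denseOnSparse_le [Nonempty V] (p : unitInterval) {κ : ℝ} (hκ : 0 < κ)
    (hκ1 : κ ≤ 1) (hp : 16 / κ ≤ p * (Fintype.card V : ℝ))
    (B : SimpleGraph V → Finset (Sym2 V)) (hB : ∀ Γ, B Γ ⊆ (⊤ : SimpleGraph V).edgeFinset)
    (hd : ∀ Γ : SimpleGraph V, Disjoint Γ.edgeFinset (B Γ)) :
    SimpleGraph.binomialRandom V p {G | ¬ DenseOnSparse G p (κ ^ 2 / 128) κ B} ≤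
      ENNReal.ofReal (1 / Fintype.card V) := by
  have hn : (0 : ℝ) < Fintype.card V := by exact_mod_cast Fintype.card_pos
  have hp0 : (0 : ℝ) ≤ p := p.2.1
  set n : ℝ := ((Fintype.card V : ℕ) : ℝ) with hnd
  set t : Finset (SimpleGraph V) := Finset.univ.filter fun Γ =>
    (Γ.edgeFinset.card : ℝ) ≤ κ ^ 2 / 128 * p * n ^ 2 ∧ κ * n ^ 2 ≤ (B Γ).card with ht
  set x : ℝ := κ / 8 with hx
  have hx0 : 0 < x := by positivity
  have key := measure_exists_le (SimpleGraph.binomialRandom V p) t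
    (fun Γ => {G | (Γ.edgeFinset : Set (Sym2 V)) ⊆ G.edgeSet ∧
      ((edgesIn G (B Γ)).card : ℝ) < (p : ℝ) * (B Γ).card / 4})
    (fun Γ => (p : ℝ) ^ Γ.edgeFinset.card * Real.exp (-((p : ℝ) * (B Γ).card / 4)))
    (fun x _ => by positivity)
    (fun Γ _ => binomialRandom_lower_tail p Γ.edgeFinset (B Γ)
      (SimpleGraph.edgeFinset_mono le_top) (hB Γ) (hd Γ))
  refine (measure_mono ?_).trans (key.trans (ENNReal.ofReal_le_ofReal ?_))
  · intro G hG
    simp only [DenseOnSparse, Set.mem_ofPred_eq, not_forall, not_le] at hG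
    obtain ⟨Γ, hΓ, h1, h2, h3⟩ := hG
    refine ⟨Γ, Finset.mem_filter.2 ⟨Finset.mem_univ _, h1, h2⟩, ?_, ?_⟩
    · rw [SimpleGraph.coe_edgeFinset]
      exact SimpleGraph.edgeSet_mono hΓ
    · refine h3.trans_le ?_
      calc κ * p * n ^ 2 / 4 = p * (κ * n ^ 2) / 4 := by ring
        _ ≤ _ := by gcongr
  · -- compare `p ^ e(Γ)` with `(p x) ^ e(Γ)`, whose sum over all graphs is explicit
    set E := (⊤ : SimpleGraph V).edgeFinset with hE
    have hlog : -Real.log x ≤ 8 / κ := by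
      rw [← Real.log_inv, hx, inv_div]
      linarith [Real.log_le_sub_one_of_pos (show 0 < 8 / κ by positivity)]
    have h1 : ∀ Γ ∈ t, (p : ℝ) ^ Γ.edgeFinset.card * Real.exp (-((p : ℝ) * (B Γ).card / 4)) ≤
        Real.exp (κ / 16 * p * n ^ 2 - κ * p * n ^ 2 / 4) * ((p : ℝ) * x) ^ Γ.edgeFinset.card := by
      intro Γ hΓ
      obtain ⟨h1, h2⟩ := (Finset.mem_filter.1 hΓ).2
      have h3 : 1 ≤ Real.exp (κ / 16 * p * n ^ 2) * x ^ Γ.edgeFinset.card := by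
        rw [← Real.exp_log (show 0 < x ^ Γ.edgeFinset.card by positivity), ← Real.exp_add,
          Real.one_le_exp_iff, Real.log_pow]
        have : (Γ.edgeFinset.card : ℝ) * (-Real.log x) ≤ κ ^ 2 / 128 * p * n ^ 2 * (8 / κ) := by
          have : 0 ≤ -Real.log x := by
            linarith [Real.log_nonpos hx0.le (show x ≤ 1 by rw [hx]; linarith)]
          gcongr
        have e : κ ^ 2 / 128 * p * n ^ 2 * (8 / κ) = κ / 16 * p * n ^ 2 := by field_simp; ring
        linarith
      have h4 : Real.exp (-((p : ℝ) * (B Γ).card / 4)) ≤ Real.exp (-(κ * p * n ^ 2 / 4)) := by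
        apply Real.exp_le_exp.2
        rw [neg_le_neg_iff]
        calc κ * p * n ^ 2 / 4 = p * (κ * n ^ 2) / 4 := by ring
          _ ≤ _ := by gcongr
      calc _ ≤ (p : ℝ) ^ Γ.edgeFinset.card * Real.exp (-(κ * p * n ^ 2 / 4)) *
            (Real.exp (κ / 16 * p * n ^ 2) * x ^ Γ.edgeFinset.card) :=
          (mul_le_mul_of_nonneg_left h4 (by positivity)).trans
            (le_mul_of_one_le_right (by positivity) h3)
        _ = _ := by rw [sub_eq_add_neg, Real.exp_add, mul_pow]; ring
    have h2 : ((p : ℝ) * x + 1) ^ E.card ≤ Real.exp (κ / 8 * p * n ^ 2) := by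
      have hEc : (E.card : ℝ) ≤ n ^ 2 := by
        rw [hE, SimpleGraph.card_edgeFinset_top_eq_card_choose_two]
        have : (Fintype.card V).choose 2 ≤ Fintype.card V ^ 2 := Nat.choose_le_pow _ _
        rw [hnd]; exact_mod_cast this
      calc ((p : ℝ) * x + 1) ^ E.card ≤ Real.exp ((p : ℝ) * x) ^ E.card := by
            gcongr; exact Real.add_one_le_exp _
        _ = Real.exp (E.card * ((p : ℝ) * x)) := by rw [Real.exp_nat_mul]
        _ ≤ Real.exp (n ^ 2 * ((p : ℝ) * x)) := by gcongr
        _ = _ := by rw [hx]; ring_nf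
    calc _ ≤ ∑ Γ ∈ t, Real.exp (κ / 16 * p * n ^ 2 - κ * p * n ^ 2 / 4) *
            ((p : ℝ) * x) ^ Γ.edgeFinset.card := Finset.sum_le_sum h1
      _ ≤ ∑ Γ : SimpleGraph V, Real.exp (κ / 16 * p * n ^ 2 - κ * p * n ^ 2 / 4) *
            ((p : ℝ) * x) ^ Γ.edgeFinset.card :=
          Finset.sum_le_sum_of_subset_of_nonneg (Finset.subset_univ _) fun _ _ _ => by positivity
      _ = Real.exp (κ / 16 * p * n ^ 2 - κ * p * n ^ 2 / 4) * ((p : ℝ) * x + 1) ^ E.card := by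
          rw [← Finset.mul_sum, sum_pow_card_edgeFinset]
      _ ≤ Real.exp (κ / 16 * p * n ^ 2 - κ * p * n ^ 2 / 4) * Real.exp (κ / 8 * p * n ^ 2) := by
          gcongr
      _ = Real.exp (-(κ / 16 * p * n * n)) := by rw [← Real.exp_add]; ring_nf
      _ ≤ Real.exp (-n) := by
          apply Real.exp_le_exp.2
          rw [div_le_iff₀ hκ] at hp
          have : 1 * n ≤ κ / 16 * p * n * n := by gcongr; linarith
          linarith
      _ ≤ _ := exp_neg_le_one_div hn
end

/-! ### Paths as lists and Pósa rotations -/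

section
open scoped Classical
variable {V : Type*}

/-- `l` lists the vertices of a path of `Γ` in order. -/
def IsPathList (Γ : SimpleGraph V) (l : List V) : Prop :=
  l.IsChain Γ.Adj ∧ l.Nodup

/-- `l` lists the vertices of a cycle of `Γ` in order. -/
def IsCycleList (Γ : SimpleGraph V) (l : List V) : Prop :=
  IsPathList Γ l ∧ 3 ≤ l.length ∧ ∀ x ∈ l.getLast?, ∀ y ∈ l.head?, Γ.Adj x y

/-- `l` lists the vertices of a longest path of `Γ`. -/
def IsLongestPath (Γ : SimpleGraph V) (l : List V) : Prop :=
  IsPathList Γ l ∧ ∀ l', IsPathList Γ l' → l'.length ≤ l.length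

theorem IsPathList.mono {Γ Γ' : SimpleGraph V} (h : Γ ≤ Γ') {l : List V} (hl : IsPathList Γ l) :
    IsPathList Γ' l :=
  ⟨hl.1.imp fun _ _ => @h _ _, hl.2⟩

theorem IsPathList.reverse {Γ : SimpleGraph V} {l : List V} (hl : IsPathList Γ l) :
    IsPathList Γ l.reverse :=
  ⟨List.isChain_reverse.2 (hl.1.imp fun _ _ h => h.symm), List.nodup_reverse.2 hl.2⟩

/-- One Pósa rotation: the last vertex of the list is fixed, and the first vertex is adjacent
to `v`. -/
inductive PosaRotation (Γ : SimpleGraph V) : List V → List V → Prop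
  | mk (A : List V) (x v : V) (B : List V) (hx : x ∈ A.head?) (h : Γ.Adj x v) :
      PosaRotation Γ (A ++ v :: B) (A.reverse ++ v :: B)

theorem PosaRotation.isPathList {Γ : SimpleGraph V} {P Q : List V} (h : PosaRotation Γ P Q)
    (hP : IsPathList Γ P) : IsPathList Γ Q := by
  obtain ⟨A, x, v, B, hx, hadj⟩ := h
  obtain ⟨hc, hn⟩ := hP
  rw [List.isChain_append] at hc
  refine ⟨List.isChain_append.2 ⟨List.isChain_reverse.2 (hc.1.imp fun _ _ h => h.symm), hc.2.1, ?_⟩,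
    ?_⟩
  · intro a ha b hb
    rw [List.getLast?_reverse] at ha
    obtain rfl : a = x := Option.mem_unique ha hx
    simp only [List.head?_cons, Option.mem_def, Option.some.injEq] at hb
    exact hb ▸ hadj
  · exact (((List.reverse_perm A).append_right _).nodup_iff).2 hn

theorem PosaRotation.perm {Γ : SimpleGraph V} {P Q : List V} (h : PosaRotation Γ P Q) :
    Q.Perm P := by
  obtain ⟨A, x, v, B, hx, hadj⟩ := h
  exact (List.reverse_perm A).append_right _

theorem PosaRotation.getLast? {Γ : SimpleGraph V} {P Q : List V} (h : PosaRotation Γ P Q) :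
    Q.getLast? = P.getLast? := by
  obtain ⟨A, x, v, B, hx, hadj⟩ := h
  simp [List.getLast?_append, List.getLast?_cons]

/-- `a` and `b` occur in `L` in consecutive positions, in this order. -/
def NextIn (a b : V) (L : List V) : Prop := ∃ s t, L = s ++ a :: b :: t

theorem NextIn.reverse {a b : V} {L : List V} (h : NextIn a b L) : NextIn b a L.reverse := by
  obtain ⟨s, t, rfl⟩ := h
  exact ⟨t.reverse, s.reverse, by simp⟩

theorem NextIn.right_unique {a b c : V} {L : List V} (hL : L.Nodup) (hb : NextIn a b L)
    (hc : NextIn a c L) : b = c := by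
  obtain ⟨s, t, rfl⟩ := hb
  obtain ⟨s', t', h⟩ := hc
  have h1 : a ∉ s ∧ a ∉ b :: t := by
    rw [List.nodup_append] at hL
    refine ⟨fun ha => hL.2.2 a ha a (by simp) rfl, (List.nodup_cons.1 hL.2.1).1⟩
  have := ((List.append_cons_inj_of_notMem h1.1 h1.2).1 h).2.2
  exact (List.cons.inj this).1

theorem NextIn.left_unique {a b c : V} {L : List V} (hL : L.Nodup) (hb : NextIn b a L)
    (hc : NextIn c a L) : b = c :=
  NextIn.right_unique (List.nodup_reverse.2 hL) hb.reverse hc.reverse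

theorem PosaRotation.nextIn {Γ : SimpleGraph V} {P Q : List V} (h : PosaRotation Γ P Q) {a b : V}
    (hab : NextIn a b P) (ha : a ∉ Q.head?) : NextIn a b Q ∨ NextIn b a Q := by
  obtain ⟨A, x, v, B, hx, hadj⟩ := h
  obtain ⟨s, t, e⟩ := hab
  rcases List.append_eq_append_iff.1 e with ⟨as, rfl, h2⟩ | ⟨bs, rfl, h2⟩
  · rw [h2]
    exact Or.inl ⟨A.reverse ++ as, t, by simp⟩
  · match bs, h2 with
    | [], h2 =>
      rw [List.nil_append] at h2
      rw [← h2]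
      exact Or.inl ⟨_, t, rfl⟩
    | [c], h2 =>
      obtain ⟨rfl, _⟩ := List.cons.inj h2
      simp at ha
    | c :: d :: bs, h2 =>
      obtain ⟨rfl, h3⟩ := List.cons.inj h2
      obtain ⟨rfl, h4⟩ := List.cons.inj h3
      exact Or.inr ⟨bs.reverse, s.reverse ++ v :: B, by simp⟩

/-- First vertices of the paths obtained from `P` by rotations. -/
def rotationEnds (Γ : SimpleGraph V) (P : List V) : Set V :=
  {x | ∃ Q, Relation.ReflTransGen (PosaRotation Γ) P Q ∧ x ∈ Q.head?}

/-- Along rotations the vertex set and the last vertex are kept, and an edge of `P` can be broken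
only if one of its two ends becomes an end of the path. -/
theorem rotation_invariants {Γ : SimpleGraph V} {P Q : List V}
    (h : Relation.ReflTransGen (PosaRotation Γ) P Q) (hP : IsPathList Γ P) :
    IsPathList Γ Q ∧ Q.Perm P ∧ Q.getLast? = P.getLast? ∧
    ∀ a b, a ∉ rotationEnds Γ P → b ∉ rotationEnds Γ P → NextIn a b P →
      NextIn a b Q ∨ NextIn b a Q := by
  induction h with
  | refl => exact ⟨hP, List.Perm.refl _, rfl, fun a b _ _ h => Or.inl h⟩
  | tail h1 h2 ih =>
    obtain ⟨i1, i2, i3, i4⟩ := ih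
    refine ⟨h2.isPathList i1, h2.perm.trans i2, h2.getLast?.trans i3, fun a b ha hb h => ?_⟩
    have hend : ∀ c, c ∉ rotationEnds Γ P → c ∉ (List.head? _) :=
      fun c hc hc' => hc ⟨_, h1.tail h2, hc'⟩
    rcases i4 a b ha hb h with h | h
    · exact h2.nextIn h (hend a ha)
    · exact (h2.nextIn h (hend b hb)).symm

theorem nextIn_append_cons {A B : List V} {v a : V} (hn : (A ++ v :: B).Nodup)
    (h : NextIn a v (A ++ v :: B)) : a ∈ A.getLast? := by
  obtain ⟨s, t, e⟩ := h
  have h1 : v ∉ A ∧ v ∉ B := by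
    rw [List.nodup_append] at hn
    exact ⟨fun ha => hn.2.2 v ha v (by simp) rfl, (List.nodup_cons.1 hn.2.1).1⟩
  have e' : A ++ v :: B = (s ++ [a]) ++ v :: t := by rw [e]; simp
  rw [((List.append_cons_inj_of_notMem h1.1 h1.2).1 e').1]
  simp

theorem nextIn_append_cons' {A B : List V} {v b : V} (hn : (A ++ v :: B).Nodup)
    (h : NextIn v b (A ++ v :: B)) : b ∈ B.head? := by
  obtain ⟨s, t, e⟩ := h
  have h1 : v ∉ A ∧ v ∉ B := by
    rw [List.nodup_append] at hn
    exact ⟨fun ha => hn.2.2 v ha v (by simp) rfl, (List.nodup_cons.1 hn.2.1).1⟩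
  rw [((List.append_cons_inj_of_notMem h1.1 h1.2).1 e).2.2]
  simp

/-- Pósa's lemma: a neighbour of an end `x ∈ rotationEnds Γ P` that is not itself an end is next,
on the original path `P`, to an end. -/
theorem exists_nextIn_of_adj_rotationEnds {Γ : SimpleGraph V} {P : List V}
    (hP : IsLongestPath Γ P) {x v : V} (hx : x ∈ rotationEnds Γ P) (hxv : Γ.Adj x v)
    (hv : v ∉ rotationEnds Γ P) :
    ∃ a ∈ rotationEnds Γ P, NextIn a v P ∨ NextIn v a P := by
  obtain ⟨Q, hQ, hxQ⟩ := hx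
  obtain ⟨q1, q2, q3, q4⟩ := rotation_invariants hQ hP.1
  have hvQ : v ∈ Q := by
    by_contra hvQ
    have h1 : IsPathList Γ (v :: Q) := by
      refine ⟨List.isChain_cons.2 ⟨fun y hy => ?_, q1.1⟩, List.nodup_cons.2 ⟨hvQ, q1.2⟩⟩
      rw [Option.mem_unique hy hxQ]
      exact hxv.symm
    have h2 := hP.2 _ h1
    rw [List.length_cons, q2.length_eq] at h2
    omega
  have hvP : v ∈ P := q2.mem_iff.1 hvQ
  obtain ⟨A, B, rfl⟩ := List.mem_iff_append.1 hvQ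
  obtain ⟨A0, B0, rfl⟩ := List.mem_iff_append.1 hvP
  have hA : A ≠ [] := by
    rintro rfl
    simp only [List.nil_append, List.head?_cons, Option.mem_def, Option.some.injEq] at hxQ
    exact hxv.ne hxQ.symm
  have hA0 : A0 ≠ [] := by
    rintro rfl
    exact hv ⟨_, Relation.ReflTransGen.refl, by simp⟩
  have hxA : x ∈ A.head? := by
    rcases A with _ | ⟨c, A⟩
    · exact absurd rfl hA
    · simpa using hxQ
  -- the predecessor `w` of `v` on `Q` becomes an end
  obtain ⟨w, hw⟩ : ∃ w, w ∈ A.getLast? := ⟨A.getLast hA, List.getLast?_eq_getLast_of_ne_nil hA⟩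
  have hwS : w ∈ rotationEnds Γ (A0 ++ v :: B0) := by
    refine ⟨_, hQ.tail (PosaRotation.mk A x v B hxA hxv), ?_⟩
    rcases A with _ | ⟨c, A⟩
    · exact absurd rfl hA
    · simp only [List.head?_append, List.head?_reverse]
      rw [Option.mem_def] at hw
      simp [hw]
  by_contra hcon
  push Not at hcon
  obtain ⟨A1, a, rfl⟩ : ∃ A1 a, A0 = A1 ++ [a] :=
    ⟨A0.dropLast, A0.getLast hA0, (List.dropLast_append_getLast hA0).symm⟩
  have haP : NextIn a v (A1 ++ [a] ++ v :: B0) := ⟨A1, B0, by simp⟩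
  have haS : a ∉ rotationEnds Γ (A1 ++ [a] ++ v :: B0) := fun h => (hcon a h).1 haP
  have key : ∀ c, c ∉ rotationEnds Γ (A1 ++ [a] ++ v :: B0) →
      (NextIn c v (A ++ v :: B) ∨ NextIn v c (A ++ v :: B)) → c ∈ B.head? := by
    rintro c hc (h | h)
    · exact absurd (Option.mem_unique (nextIn_append_cons q1.2 h) hw ▸ hwS) hc
    · exact nextIn_append_cons' q1.2 h
  have haB := key a haS (q4 a v haS hv haP)
  rcases B0 with _ | ⟨b, B0⟩
  · -- `v` is the last vertex of `P`, hence of `Q`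
    have h1 : (A ++ v :: B).getLast? = some v := by rw [q3]; simp
    rcases B with _ | ⟨c, B⟩
    · simp at haB
    · have h2 : v ∈ c :: B := by
        rw [List.getLast?_append, List.getLast?_cons_cons] at h1
        have h3 : (c :: B).getLast? = some v := by
          rw [List.getLast?_eq_getLast_of_ne_nil (by simp)] at h1 ⊢
          simpa using h1
        exact List.mem_of_getLast? h3
      have := q1.2
      rw [List.nodup_append] at this
      exact (List.nodup_cons.1 this.2.1).1 h2
  · have hbP : NextIn v b (A1 ++ [a] ++ v :: b :: B0) := ⟨A1 ++ [a], B0, rfl⟩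
    have hbS : b ∉ rotationEnds Γ (A1 ++ [a] ++ v :: b :: B0) := fun h => (hcon b h).2 hbP
    have hbB := key b hbS (q4 v b hv hbS hbP).symm
    obtain rfl : a = b := Option.mem_unique haB hbB
    have := hP.1.2
    simp only [List.append_assoc, List.nodup_append] at this
    exact this.2.1.2.2 a (by simp) a (by simp) rfl

/-- Every proper nonempty subset of `W` sends an edge to the rest of `W`. -/
def ConnectedOn (Γ : SimpleGraph V) (W : Finset V) : Prop :=
  ∀ A ⊆ W, A.Nonempty → A ≠ W → ∃ a ∈ A, ∃ b ∈ W, b ∉ A ∧ Γ.Adj a b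

/-- An edge joining the two ends of a path closes it to a cycle, which is Hamiltonian on `W` or, by
connectivity, can be opened to a longer path. -/
theorem longer_path_of_closing_edge {Γ Γ' : SimpleGraph V} (hle : Γ ≤ Γ') {W : Finset V}
    (hΓ : ∀ a b, Γ.Adj a b → a ∈ W) (hcon : ConnectedOn Γ W) {P : List V}
    (hP : IsPathList Γ P) (hlen : 3 ≤ P.length) {x y : V} (hx : x ∈ P.head?)
    (hy : y ∈ P.getLast?) (hxy : Γ'.Adj x y) :
    (∃ l, IsCycleList Γ' l ∧ l.toFinset = W) ∨
      ∃ P', IsPathList Γ' P' ∧ P'.length = P.length + 1 := by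
  have hPW : P.toFinset ⊆ W := by
    intro a ha
    obtain ⟨A, B, rfl⟩ := List.mem_iff_append.1 (List.mem_toFinset.1 ha)
    have hc := List.isChain_append.1 hP.1
    rcases B with _ | ⟨b, B⟩
    · have hA : A ≠ [] := by rintro rfl; simp at hlen
      exact hΓ _ _ (hc.2.2 (A.getLast hA) (List.getLast?_eq_getLast_of_ne_nil hA) a (by simp)).symm
    · exact hΓ _ _ (List.isChain_cons_cons.1 hc.2.1).1
  by_cases hW : P.toFinset = W
  · left
    refine ⟨P, ⟨hP.mono hle, hlen, fun a ha b hb => ?_⟩, hW⟩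
    rw [Option.mem_unique ha hy, Option.mem_unique hb hx]
    exact hxy.symm
  · right
    have hne : P.toFinset.Nonempty := by
      rcases P with _ | ⟨c, P⟩
      · simp at hlen
      · exact ⟨c, by simp⟩
    obtain ⟨a, ha, b, _, hbP, hab⟩ := hcon _ hPW hne hW
    obtain ⟨A, B, rfl⟩ := List.mem_iff_append.1 (List.mem_toFinset.1 ha)
    have hP' := hP.mono hle
    have hc := List.isChain_append.1 hP'.1
    rw [List.mem_toFinset] at hbP
    refine ⟨b :: ((a :: B) ++ A), ⟨List.isChain_cons.2 ⟨?_, List.isChain_append.2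
      ⟨hc.2.1, hc.1, ?_⟩⟩, List.nodup_cons.2 ⟨?_, ?_⟩⟩, ?_⟩
    · intro c hc
      obtain rfl : a = c := by simpa using hc
      exact hle hab.symm
    · intro c hc d hd
      have h1 : c = y := by
        refine Option.mem_unique hc ?_
        rw [List.getLast?_append] at hy
        rw [List.getLast?_eq_getLast_of_ne_nil (by simp)] at hy ⊢
        simpa using hy
      have h2 : d = x := by
        refine Option.mem_unique hd ?_
        rcases A with _ | ⟨e, A⟩
        · simp at hd
        · simpa using hx
      rw [h1, h2]
      exact hxy.symm
    · exact fun h => hbP ((List.perm_append_comm.mem_iff).1 h)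
    · exact (List.perm_append_comm.nodup_iff).1 hP'.2
    · simp only [List.length_cons, List.length_append]
      omega
variable [Fintype V]

/-- The vertices outside `A` with a neighbour in `A`. -/
noncomputable def outerNbhd (Γ : SimpleGraph V) (A : Finset V) : Finset V :=
  Finset.univ.filter fun v => v ∉ A ∧ ∃ a ∈ A, Γ.Adj a v

theorem mem_outerNbhd {Γ : SimpleGraph V} {A : Finset V} {v : V} :
    v ∈ outerNbhd Γ A ↔ v ∉ A ∧ ∃ a ∈ A, Γ.Adj a v := by
  simp [outerNbhd]

theorem card_outerNbhd_rotationEnds_le {Γ : SimpleGraph V} {P : List V}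
    (hP : IsLongestPath Γ P) :
    (outerNbhd Γ (rotationEnds Γ P).toFinset).card ≤ 2 * (rotationEnds Γ P).toFinset.card := by
  set S := (rotationEnds Γ P).toFinset with hS
  have h1 : outerNbhd Γ S ⊆ (Finset.univ.filter fun v => ∃ a ∈ S, NextIn a v P) ∪
      (Finset.univ.filter fun v => ∃ a ∈ S, NextIn v a P) := by
    intro v hv
    obtain ⟨hv, x, hx, hxv⟩ := mem_outerNbhd.1 hv
    simp only [hS, Set.mem_toFinset] at hv hx
    obtain ⟨a, ha, h⟩ := exists_nextIn_of_adj_rotationEnds hP hx hxv hv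
    simp only [Finset.mem_union, Finset.mem_filter, Finset.mem_univ, true_and, hS,
      Set.mem_toFinset]
    exact h.imp (fun h => ⟨a, ha, h⟩) (fun h => ⟨a, ha, h⟩)
  have h2 : (Finset.univ.filter fun v => ∃ a ∈ S, NextIn a v P).card ≤ S.card :=
    Finset.card_le_card_of_forall_subsingleton (fun v a => NextIn a v P)
      (fun v hv => (Finset.mem_filter.1 hv).2) fun a _ v hv w hw => hv.2.right_unique hP.1.2 hw.2
  have h3 : (Finset.univ.filter fun v => ∃ a ∈ S, NextIn v a P).card ≤ S.card :=
    Finset.card_le_card_of_forall_subsingleton (fun v a => NextIn v a P)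
      (fun v hv => (Finset.mem_filter.1 hv).2) fun a _ v hv w hw => hv.2.left_unique hP.1.2 hw.2
  calc _ ≤ _ := Finset.card_le_card h1
    _ ≤ _ := Finset.card_union_le _ _
    _ ≤ _ := by omega

/-- The pairs of ends of longest paths of `Γ`. -/
noncomputable def longestPathEnds (Γ : SimpleGraph V) : Finset (V × V) :=
  Finset.univ.filter fun x => ∃ P, IsLongestPath Γ P ∧ x.1 ∈ P.head? ∧ x.2 ∈ P.getLast?

theorem exists_isLongestPath (Γ : SimpleGraph V) : ∃ P, IsLongestPath Γ P := by
  have hb : ∀ l, IsPathList Γ l → l.length ≤ Fintype.card V := fun l hl => hl.2.length_le_card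
  obtain ⟨l, hl, hlen⟩ := Nat.findGreatest_spec (P := fun m => ∃ l, IsPathList Γ l ∧ l.length = m)
    (Nat.zero_le (Fintype.card V)) ⟨[], ⟨by simp, by simp⟩, rfl⟩
  refine ⟨l, hl, fun l' hl' => ?_⟩
  rw [hlen]
  exact Nat.le_findGreatest (hb l' hl') ⟨l', hl', rfl⟩

theorem swap_mem_longestPathEnds {Γ : SimpleGraph V} {x y : V}
    (h : (x, y) ∈ longestPathEnds Γ) : (y, x) ∈ longestPathEnds Γ := by
  obtain ⟨P, hP, h1, h2⟩ := (Finset.mem_filter.1 h).2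
  exact Finset.mem_filter.2 ⟨Finset.mem_univ _, P.reverse,
    ⟨hP.1.reverse, fun l hl => by simpa using hP.2 l hl⟩, by simpa using h2, by simpa using h1⟩

/-- In a graph expanding sets of size at most `k` by a factor more than two there are more than
`k ^ 2` pairs of ends of longest paths. -/
theorem sq_le_card_longestPathEnds {Γ : SimpleGraph V} {W : Finset V}
    (hΓ : ∀ a b, Γ.Adj a b → a ∈ W) {x y : V} (hxy : Γ.Adj x y) {k : ℕ}
    (hexp : ∀ A ⊆ W, A.Nonempty → A.card ≤ k → 2 * A.card < (outerNbhd Γ A).card) :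
    k ^ 2 ≤ (longestPathEnds Γ).card := by
  have hlen : ∀ P, IsLongestPath Γ P → 2 ≤ P.length := fun P hP =>
    hP.2 [x, y] ⟨by simpa using hxy, by simpa using hxy.ne⟩
  have hsub : ∀ P, IsLongestPath Γ P → ∀ a ∈ P.head?, a ∈ W := by
    intro P hP a ha
    have := hlen P hP
    rcases P with _ | ⟨b, _ | ⟨c, P⟩⟩
    · simp at this
    · simp at this
    · obtain rfl : b = a := by simpa using ha
      exact hΓ b c (List.isChain_cons_cons.1 hP.1.1).1
  have hrot : ∀ P, IsLongestPath Γ P → ∀ Q, Relation.ReflTransGen (PosaRotation Γ) P Q →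
      IsLongestPath Γ Q ∧ Q.getLast? = P.getLast? := by
    intro P hP Q hQ
    obtain ⟨q1, q2, q3, -⟩ := rotation_invariants hQ hP.1
    exact ⟨⟨q1, fun l hl => (hP.2 l hl).trans_eq q2.length_eq.symm⟩, q3⟩
  -- the other ends of longest paths that end in `u`
  have hend : ∀ P, IsLongestPath Γ P → ∀ u ∈ P.getLast?,
      k ≤ ((longestPathEnds Γ).filter fun z => z.2 = u).card := by
    intro P hP u hu
    set S := (rotationEnds Γ P).toFinset with hS
    have hSW : S ⊆ W := by
      intro a ha
      obtain ⟨Q, hQ, haQ⟩ := Set.mem_toFinset.1 ha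
      exact hsub Q (hrot P hP Q hQ).1 a haQ
    have hne : S.Nonempty := by
      have : P ≠ [] := by rintro rfl; simpa using hlen [] hP
      exact ⟨P.head this, Set.mem_toFinset.2 ⟨P, Relation.ReflTransGen.refl,
        List.head?_eq_some_head this⟩⟩
    have hk : k < S.card := by
      by_contra hk
      exact absurd (card_outerNbhd_rotationEnds_le hP)
        (not_le.2 (hexp S hSW hne (not_lt.1 hk)))
    refine hk.le.trans (Finset.card_le_card_of_injOn (fun a => (a, u)) ?_ ?_)
    · intro a ha
      obtain ⟨Q, hQ, haQ⟩ := Set.mem_toFinset.1 ha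
      obtain ⟨hQ1, hQ2⟩ := hrot P hP Q hQ
      simp only [Finset.coe_filter, Set.mem_ofPred_eq, and_true]
      exact Finset.mem_filter.2 ⟨Finset.mem_univ _, Q, hQ1, haQ, hQ2 ▸ hu⟩
    · intro a _ b _ h
      exact (Prod.mk.inj h).1
  obtain ⟨P, hP⟩ := exists_isLongestPath Γ
  have hne : P ≠ [] := by rintro rfl; simpa using hlen [] hP
  have hu : P.getLast hne ∈ P.getLast? := List.getLast?_eq_getLast_of_ne_nil hne
  set u := P.getLast hne
  set T := (longestPathEnds Γ).image Prod.snd with hT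
  have hT1 : k ≤ T.card := by
    refine (hend P hP u hu).trans (Finset.card_le_card_of_injOn Prod.fst ?_ ?_)
    · rintro ⟨a, b⟩ h
      obtain ⟨h1, rfl⟩ := Finset.mem_filter.1 h
      exact Finset.mem_image.2 ⟨_, swap_mem_longestPathEnds h1, rfl⟩
    · rintro ⟨a, b⟩ h ⟨a', b'⟩ h' e
      obtain ⟨_, rfl⟩ := Finset.mem_filter.1 h
      obtain ⟨_, h2⟩ := Finset.mem_filter.1 h'
      exact Prod.ext e h2.symm
  calc k ^ 2 = k * k := sq k
    _ ≤ k * T.card := by gcongr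
    _ ≤ _ := Finset.mul_card_image_le_card_of_maps_to
        (fun a ha => Finset.mem_image_of_mem _ ha) k (by
          intro b hb
          obtain ⟨⟨a, b'⟩, h, rfl⟩ := Finset.mem_image.1 hb
          obtain ⟨P, hP, _, h2⟩ := (Finset.mem_filter.1 h).2
          exact hend P hP b' h2)

end

/-! ### Depth-first search and short cycles -/

section
open scoped Classical
variable {V : Type*}

/-- Any two disjoint subsets of `W` of size at least `d` are joined by an edge. -/
def JoinedOn (h : SimpleGraph V) (W : Finset V) (d : ℝ) : Prop :=
  ∀ A ⊆ W, ∀ B ⊆ W, Disjoint A B → d ≤ A.card → d ≤ B.card → ∃ a ∈ A, ∃ b ∈ B, h.Adj a b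

theorem JoinedOn.subset {h : SimpleGraph V} {W W' : Finset V} {d : ℝ} (hj : JoinedOn h W d)
    (hW : W' ⊆ W) : JoinedOn h W' d :=
  fun A hA B hB => hj A (hA.trans hW) B (hB.trans hW)

/-- The states of a depth-first search: a path `l` and a set `S` of finished vertices, with no
edge from `S` to the vertices not yet visited. Every step of the search (visiting a vertex, or
finishing the head of `l`) raises `2 |S| + |l|` by one. -/
theorem exists_dfs_state (h : SimpleGraph V) (U : Finset V) (k : ℕ) (hk : k ≤ U.card) :
    ∃ (S : Finset V) (l : List V), IsPathList h l ∧ S ⊆ U ∧ (∀ x ∈ l, x ∈ U ∧ x ∉ S) ∧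
      (∀ a ∈ S, ∀ b ∈ U, b ∉ S → b ∉ l → ¬ h.Adj a b) ∧ 2 * S.card + l.length = k := by
  induction k with
  | zero => exact ⟨∅, [], ⟨by simp, by simp⟩, by simp, by simp, by simp, by simp⟩
  | succ k ih =>
    obtain ⟨S, l, hl, hSU, hlU, hno, hcard⟩ := ih (by omega)
    rcases l with _ | ⟨x, l⟩
    · obtain ⟨u, hu, huS⟩ : ∃ u ∈ U, u ∉ S := by
        by_contra! hcon
        have h1 : U.card ≤ S.card := Finset.card_le_card hcon
        simp only [List.length_nil] at hcard
        omega
      refine ⟨S, [u], ⟨by simp, by simp⟩, hSU, by simp [hu, huS], ?_, by simp at hcard ⊢; omega⟩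
      exact fun a ha b hb hbS _ => hno a ha b hb hbS (by simp)
    · by_cases hx : ∃ u ∈ U, u ∉ S ∧ u ∉ x :: l ∧ h.Adj x u
      · obtain ⟨u, hu, huS, hul, hxu⟩ := hx
        refine ⟨S, u :: x :: l, ⟨List.isChain_cons_cons.2 ⟨hxu.symm, hl.1⟩,
          List.nodup_cons.2 ⟨hul, hl.2⟩⟩, hSU, ?_, ?_, by simp at hcard ⊢; omega⟩
        · intro y hy
          rcases List.mem_cons.1 hy with rfl | hy
          · exact ⟨hu, huS⟩
          · exact hlU y hy
        · exact fun a ha b hb hbS hbl => hno a ha b hb hbS fun h' => hbl (List.mem_cons_of_mem _ h')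
      · push Not at hx
        obtain ⟨hxU, hxS⟩ := hlU x (by simp)
        have hxl : x ∉ l := (List.nodup_cons.1 hl.2).1
        refine ⟨insert x S, l, ⟨(List.isChain_cons.1 hl.1).2, (List.nodup_cons.1 hl.2).2⟩,
          Finset.insert_subset hxU hSU, ?_, ?_, ?_⟩
        · intro y hy
          obtain ⟨h1, h2⟩ := hlU y (List.mem_cons_of_mem _ hy)
          refine ⟨h1, fun h3 => ?_⟩
          rcases Finset.mem_insert.1 h3 with rfl | h3
          · exact hxl hy
          · exact h2 h3
        · intro a ha b hb hbS hbl
          rw [Finset.mem_insert, not_or] at hbS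
          have hb' : b ∉ x :: l := by simp [hbS.1, hbl]
          rcases Finset.mem_insert.1 ha with rfl | ha
          · exact hx b hb hbS.2 hb'
          · exact hno a ha b hb hbS.2 hb'
        · rw [Finset.card_insert_of_notMem hxS]
          simp at hcard; omega

/-- When `2 |S| + |l| = |U|` in the depth-first search, `S` is as large as the set of unvisited
vertices, and there is no edge between them; hence both are small and the path `l` is long. -/
theorem JoinedOn.exists_path {h : SimpleGraph V} {U : Finset V} {d : ℝ} (hj : JoinedOn h U d) :
    ∃ l, IsPathList h l ∧ (∀ x ∈ l, x ∈ U) ∧ (U.card : ℝ) ≤ l.length + 2 * d := by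
  obtain ⟨S, l, hl, hSU, hlU, hno, hcard⟩ := exists_dfs_state h U U.card le_rfl
  refine ⟨l, hl, fun x hx => (hlU x hx).1, ?_⟩
  have hlS : Disjoint l.toFinset S := Finset.disjoint_left.2 fun x hx => (hlU x (by simpa using hx)).2
  have hsub : l.toFinset ∪ S ⊆ U :=
    Finset.union_subset (fun x hx => (hlU x (by simpa using hx)).1) hSU
  have hR : (U \ (l.toFinset ∪ S)).card = S.card := by
    rw [Finset.card_sdiff_of_subset hsub, Finset.card_union_of_disjoint hlS,
      List.toFinset_card_of_nodup hl.2]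
    omega
  have hd : (S.card : ℝ) < d := by
    by_contra hd
    rw [not_lt] at hd
    obtain ⟨a, ha, b, hb, hab⟩ := hj S hSU (U \ (l.toFinset ∪ S)) Finset.sdiff_subset
      (Finset.disjoint_left.2 fun x hx hx' => (Finset.mem_sdiff.1 hx').2 (by simp [hx])) hd
      (by rw [hR]; exact hd)
    obtain ⟨hbU, hb⟩ := Finset.mem_sdiff.1 hb
    simp only [Finset.mem_union, List.mem_toFinset, not_or] at hb
    exact hno a ha b hbU hb.2 hb.1 hab
  have : (U.card : ℝ) = 2 * S.card + l.length := by exact_mod_cast hcard.symm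
  linarith

/-- The edges of `h` with both ends in `W`, as a graph on all vertices. -/
def graphOn (h : SimpleGraph V) (W : Finset V) : SimpleGraph V where
  Adj a b := h.Adj a b ∧ a ∈ W ∧ b ∈ W
  symm := ⟨fun _ _ h => ⟨h.1.symm, h.2.2, h.2.1⟩⟩
  loopless := ⟨fun _ h => h.1.ne rfl⟩

theorem graphOn_le (h : SimpleGraph V) (W : Finset V) : graphOn h W ≤ h := fun _ _ hab => hab.1

variable [Fintype V]

/-- Two disjoint branchings rooted at `a` and `b`, whose layers double in size: the `t`-th layers
`L` and `R` have `2 ^ t` vertices, and any `x ∈ L` and `y ∈ R` are joined to `a` and `b` by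
disjoint paths with exactly `t` edges. -/
theorem exists_doubling_layers {h : SimpleGraph V} {W : Finset V} {M : ℕ}
    (hexp : ∀ A ⊆ W, A.Nonempty → A.card ≤ M → 8 * A.card ≤ (outerNbhd (graphOn h W) A).card)
    {a b : V} (ha : a ∈ W) (hb : b ∈ W) (hab : a ≠ b) (t : ℕ) (ht : 2 ^ t ≤ 2 * M) :
    ∃ U L R : Finset V, U ⊆ W ∧ L ⊆ U ∧ R ⊆ U ∧ Disjoint L R ∧ L.card = 2 ^ t ∧ R.card = 2 ^ t ∧
      U.card ≤ 4 * 2 ^ t ∧ ∀ x ∈ L, ∀ y ∈ R, ∃ lx ly : List V, lx.IsChain h.Adj ∧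
        ly.IsChain h.Adj ∧ (lx ++ ly).Nodup ∧ (∀ z ∈ lx ++ ly, z ∈ U) ∧ x ∈ lx.head? ∧
        a ∈ lx.getLast? ∧ y ∈ ly.head? ∧ b ∈ ly.getLast? ∧ lx.length = t + 1 ∧
        ly.length = t + 1 := by
  induction t with
  | zero =>
    refine ⟨{a, b}, {a}, {b}, ?_, by simp, by simp, by simpa using hab, by simp, by simp, ?_, ?_⟩
    · intro x hx
      rcases Finset.mem_insert.1 hx with rfl | hx
      · exact ha
      · rw [Finset.mem_singleton.1 hx]; exact hb
    · have := Finset.card_le_two (a := a) (b := b)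
      omega
    · intro x hx y hy
      rw [Finset.mem_singleton] at hx hy
      subst hx hy
      exact ⟨[x], [y], by simp, by simp, by simpa using hab, by simp, by simp, by simp, by simp,
        by simp, by simp, by simp⟩
  | succ t ih =>
    rw [pow_succ] at ht
    obtain ⟨U, L, R, hUW, hLU, hRU, hLR, hL, hR, hU, hpath⟩ := ih (by omega)
    have hpos : 0 < 2 ^ t := by positivity
    have grow : ∀ A ⊆ U, A.card = 2 ^ t → 8 * 2 ^ t ≤ (outerNbhd (graphOn h W) A).card := by
      intro A hA hc
      rw [← hc]
      exact hexp A (hA.trans hUW) (Finset.card_pos.1 (by omega)) (by omega)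
    have hNW : ∀ A : Finset V, outerNbhd (graphOn h W) A ⊆ W := by
      intro A v hv
      obtain ⟨_, a, _, h⟩ := mem_outerNbhd.1 hv
      exact h.2.2
    obtain ⟨L', hL', hL'c⟩ : ∃ L' ⊆ outerNbhd (graphOn h W) L \ U, L'.card = 2 ^ (t + 1) := by
      apply Finset.exists_subset_card_eq
      have h1 := Finset.le_card_sdiff U (outerNbhd (graphOn h W) L)
      have h2 := grow L hLU hL
      rw [pow_succ]; omega
    obtain ⟨R', hR', hR'c⟩ : ∃ R' ⊆ outerNbhd (graphOn h W) R \ (U ∪ L'),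
        R'.card = 2 ^ (t + 1) := by
      apply Finset.exists_subset_card_eq
      have h1 := Finset.le_card_sdiff (U ∪ L') (outerNbhd (graphOn h W) R)
      have h2 := grow R hRU hR
      have h3 := Finset.card_union_le U L'
      rw [pow_succ] at hL'c ⊢; omega
    have hdis : Disjoint L' R' := Finset.disjoint_right.2 fun x hx hx' =>
      (Finset.mem_sdiff.1 (hR' hx)).2 (Finset.mem_union_right _ hx')
    refine ⟨U ∪ L' ∪ R', L', R', ?_, fun x hx => by simp [hx], fun x hx => by simp [hx], hdis,
      hL'c, hR'c, ?_, ?_⟩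
    · refine Finset.union_subset (Finset.union_subset hUW ?_) ?_
      · exact hL'.trans (Finset.sdiff_subset.trans (hNW _))
      · exact hR'.trans (Finset.sdiff_subset.trans (hNW _))
    · have h3 := Finset.card_union_le U L'
      have h4 := Finset.card_union_le (U ∪ L') R'
      rw [pow_succ] at hL'c hR'c ⊢; omega
    · intro x' hx' y' hy'
      obtain ⟨hx1, hxU⟩ := Finset.mem_sdiff.1 (hL' hx')
      obtain ⟨hy1, hyU⟩ := Finset.mem_sdiff.1 (hR' hy')
      obtain ⟨_, x, hx, hxx⟩ := mem_outerNbhd.1 hx1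
      obtain ⟨_, y, hy, hyy⟩ := mem_outerNbhd.1 hy1
      obtain ⟨lx, ly, c1, c2, c3, c4, c5, c6, c7, c8, c9, c10⟩ := hpath x hx y hy
      have hne : x' ≠ y' := fun e => Finset.disjoint_left.1 hdis hx' (e ▸ hy')
      have hyU' : y' ∉ U := fun h => hyU (Finset.mem_union_left _ h)
      refine ⟨x' :: lx, y' :: ly, List.isChain_cons.2 ⟨fun z hz => ?_, c1⟩,
        List.isChain_cons.2 ⟨fun z hz => ?_, c2⟩, ?_, ?_, by simp, ?_, by simp, ?_, by simp [c9],
        by simp [c10]⟩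
      · rw [Option.mem_unique hz c5]; exact hxx.1.symm
      · rw [Option.mem_unique hz c7]; exact hyy.1.symm
      · have hperm : ((x' :: lx) ++ (y' :: ly)).Perm (x' :: y' :: (lx ++ ly)) := by
          rw [List.cons_append]
          exact List.Perm.cons _ List.perm_middle
        rw [hperm.nodup_iff, List.nodup_cons, List.nodup_cons]
        refine ⟨fun h => ?_, fun h => hyU' (c4 _ h), c3⟩
        rcases List.mem_cons.1 h with h | h
        · exact hne h
        · exact hxU (c4 _ h)
      · intro z hz
        have : z = x' ∨ z = y' ∨ z ∈ lx ++ ly := by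
          simp only [List.cons_append, List.mem_cons, List.mem_append] at hz ⊢
          tauto
        rcases this with rfl | rfl | h
        · simp [hx']
        · simp [hy']
        · simp [c4 z h]
      · rcases lx with _ | ⟨c, lx⟩
        · simp at c6
        · rwa [List.getLast?_cons_cons]
      · rcases ly with _ | ⟨c, ly⟩
        · simp at c8
        · rwa [List.getLast?_cons_cons]

/-- A cycle of prescribed length: a segment of a path in `U`, closed through two branchings
in `W`. -/
theorem exists_cycle_of_joined_of_expanding {h : SimpleGraph V} {U W : Finset V} {d : ℝ}
    {M t m : ℕ} (hUW : Disjoint U W) (hj : JoinedOn h (U ∪ W) d)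
    (hexp : ∀ A ⊆ W, A.Nonempty → A.card ≤ M → 8 * A.card ≤ (outerNbhd (graphOn h W) A).card)
    (ht : 2 ^ t ≤ 2 * M) (hd : d ≤ 2 ^ t) (hW : 2 * d + 2 ≤ W.card) (hU : m + 4 * d < U.card) :
    ∃ l, IsCycleList h l ∧ l.length = m + 2 * t + 3 := by
  obtain ⟨l, hl, hlU, hlen⟩ := (hj.subset (Finset.subset_union_left (s₂ := W))).exists_path
  -- split `W` into two halves, so that the two roots are distinct
  obtain ⟨W1, hW1, hW1c⟩ : ∃ W1 ⊆ W, W1.card = W.card / 2 :=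
    Finset.exists_subset_card_eq (Nat.div_le_self _ _)
  have hhalf : (W.card : ℝ) ≤ 2 * (W.card / 2 : ℕ) + 1 := by
    have : W.card ≤ 2 * (W.card / 2) + 1 := by omega
    exact_mod_cast this
  have hW1d : d ≤ W1.card := by rw [hW1c]; linarith
  have hW2d : d ≤ (W \ W1).card := by
    have : W1.card ≤ (W \ W1).card := by
      rw [Finset.card_sdiff_of_subset hW1, hW1c]; omega
    exact hW1d.trans (by exact_mod_cast this)
  have hbad : ∀ Z ⊆ W, d ≤ Z.card → ((U.filter fun v => ∀ z ∈ Z, ¬ h.Adj v z).card : ℝ) < d := by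
    intro Z hZ hZd
    by_contra hcon
    obtain ⟨v, hv, z, hz, hvz⟩ := hj _ ((Finset.filter_subset _ _).trans Finset.subset_union_left)
      Z (hZ.trans Finset.subset_union_right)
      (Finset.disjoint_of_subset_left (Finset.filter_subset _ _)
        (Finset.disjoint_of_subset_right hZ hUW)) (not_lt.1 hcon) hZd
    exact (Finset.mem_filter.1 hv).2 z hz hvz
  have hb1 := hbad W1 hW1 hW1d
  have hb2 := hbad (W \ W1) Finset.sdiff_subset hW2d
  set X1 := U.filter fun v => ∀ z ∈ W1, ¬ h.Adj v z
  set X2 := U.filter fun v => ∀ z ∈ W \ W1, ¬ h.Adj v z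
  obtain ⟨i, hi, h1, h2⟩ : ∃ i, ∃ hi : i + m < l.length, l[i] ∉ X1 ∧ l[i + m] ∉ X2 := by
    by_contra! hcon
    have hsub : Finset.range (l.length - m) ⊆
        ((Finset.range (l.length - m)).filter fun i => ∃ hi : i < l.length, l[i] ∈ X1) ∪
        ((Finset.range (l.length - m)).filter fun i => ∃ hi : i + m < l.length, l[i + m] ∈ X2) := by
      intro i hi
      have hi' := Finset.mem_range.1 hi
      simp only [Finset.mem_union, Finset.mem_filter, hi, true_and]
      by_cases hx : l[i] ∈ X1
      · exact Or.inl ⟨by omega, hx⟩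
      · exact Or.inr ⟨by omega, hcon i (by omega) hx⟩
    have k1 : ((Finset.range (l.length - m)).filter fun i =>
        ∃ hi : i < l.length, l[i] ∈ X1).card ≤ X1.card := by
      refine Finset.card_le_card_of_forall_subsingleton (fun i x => l[i]? = some x) ?_ ?_
      · intro i hi
        obtain ⟨hi, hx⟩ := (Finset.mem_filter.1 hi).2
        exact ⟨_, hx, List.getElem?_eq_getElem hi⟩
      · intro x _ i hi j hj
        obtain ⟨hi', -⟩ := (Finset.mem_filter.1 hi.1).2
        exact (List.getElem?_inj hi' hl.2).1 (hi.2.trans hj.2.symm)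
    have k2 : ((Finset.range (l.length - m)).filter fun i =>
        ∃ hi : i + m < l.length, l[i + m] ∈ X2).card ≤ X2.card := by
      refine Finset.card_le_card_of_forall_subsingleton (fun i x => l[i + m]? = some x) ?_ ?_
      · intro i hi
        obtain ⟨hi, hx⟩ := (Finset.mem_filter.1 hi).2
        exact ⟨_, hx, List.getElem?_eq_getElem hi⟩
      · intro x _ i hi j hj
        obtain ⟨hi', -⟩ := (Finset.mem_filter.1 hi.1).2
        have := (List.getElem?_inj hi' hl.2).1 (hi.2.trans hj.2.symm)
        omega
    have k3 := (Finset.card_le_card hsub).trans (Finset.card_union_le _ _)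
    rw [Finset.card_range] at k3
    have k4 : (l.length : ℝ) ≤ m + (X1.card + X2.card) := by
      have : l.length ≤ m + (X1.card + X2.card) := by omega
      exact_mod_cast this
    linarith
  have hiU : l[i] ∈ U := hlU _ (List.getElem_mem _)
  have hjU : l[i + m] ∈ U := hlU _ (List.getElem_mem _)
  obtain ⟨a, haW, hia⟩ : ∃ a ∈ W1, h.Adj l[i] a := by
    by_contra! hcon
    exact h1 (Finset.mem_filter.2 ⟨hiU, hcon⟩)
  obtain ⟨b, hbW, hjb⟩ : ∃ b ∈ W \ W1, h.Adj l[i + m] b := by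
    by_contra! hcon
    exact h2 (Finset.mem_filter.2 ⟨hjU, hcon⟩)
  have hab : a ≠ b := fun e => (Finset.mem_sdiff.1 hbW).2 (e ▸ haW)
  obtain ⟨Z, L, R, hZW, hLZ, hRZ, hLR, hL, hR, -, hpath⟩ :=
    exists_doubling_layers hexp (hW1 haW) (Finset.sdiff_subset hbW) hab t ht
  obtain ⟨x, hx, y, hy, hxy⟩ := hj L ((hLZ.trans hZW).trans Finset.subset_union_right) R
    ((hRZ.trans hZW).trans Finset.subset_union_right) hLR (by rw [hL]; exact_mod_cast hd)
    (by rw [hR]; exact_mod_cast hd)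
  obtain ⟨lx, ly, c1, c2, c3, c4, c5, c6, c7, c8, c9, c10⟩ := hpath x hx y hy
  set q := (l.drop i).take (m + 1) with hq
  have hqlen : q.length = m + 1 := by
    rw [hq, List.length_take, List.length_drop]; omega
  have hqsub : q.Sublist l := (List.take_sublist _ _).trans (List.drop_sublist _ _)
  have hqchain : q.IsChain h.Adj := (hl.1.drop i).take (m + 1)
  have hqhead : l[i] ∈ q.head? := by
    rw [hq, List.head?_take, List.head?_drop]
    simp
  have hqlast : l[i + m] ∈ q.getLast? := by
    rw [List.getLast?_eq_getElem?, hqlen, hq]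
    simp
  have hqne : q ≠ [] := by rintro e; simp [e] at hqlen
  have hlxne : lx ≠ [] := by rintro rfl; simp at c9
  have hlyne : ly ≠ [] := by rintro rfl; simp at c10
  refine ⟨lx ++ (q ++ ly.reverse), ⟨⟨?_, ?_⟩, ?_, ?_⟩, ?_⟩
  · refine List.isChain_append.2 ⟨c1, List.isChain_append.2 ⟨hqchain,
      List.isChain_reverse.2 (c2.imp fun _ _ h => h.symm), ?_⟩, ?_⟩
    · intro u hu v hv
      rw [List.head?_reverse] at hv
      rw [Option.mem_unique hu hqlast, Option.mem_unique hv c8]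
      exact hjb
    · intro u hu v hv
      rw [List.head?_append_of_ne_nil _ hqne] at hv
      rw [Option.mem_unique hu c6, Option.mem_unique hv hqhead]
      exact hia.symm
  · have hperm : (lx ++ (q ++ ly.reverse)).Perm (q ++ (lx ++ ly)) := by
      refine (List.perm_append_comm_assoc _ _ _).trans ?_
      exact List.Perm.append_left _ (List.Perm.append_left _ (List.reverse_perm _))
    rw [hperm.nodup_iff, List.nodup_append]
    refine ⟨hl.2.sublist hqsub, c3, fun u hu v hv e => ?_⟩
    exact Finset.disjoint_left.1 hUW (hlU u (hqsub.subset hu)) (hZW (c4 u (e ▸ hv)))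
  · simp only [List.length_append, List.length_reverse]; omega
  · intro u hu v hv
    rw [List.getLast?_append_of_ne_nil _ (by simp [hqne]),
      List.getLast?_append_of_ne_nil _ (by simpa using hlyne), List.getLast?_reverse] at hu
    rw [List.head?_append_of_ne_nil _ hlxne] at hv
    rw [Option.mem_unique hu c7, Option.mem_unique hv c5]
    exact hxy.symm
  · simp only [List.length_append, List.length_reverse]; omega
end

/-! ### Expansion and subgraphs of prescribed order -/

section
open scoped Classical
variable {V : Type*}

/-- The number of neighbours of `v` in `W`. -/
noncomputable def degIn (h : SimpleGraph V) (W : Finset V) (v : V) : ℕ :=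
  (W.filter (h.Adj v)).card

theorem card_adjPairs (h : SimpleGraph V) (A B : Finset V) :
    (adjPairs h A B).card = ∑ a ∈ A, degIn h B a := by
  unfold adjPairs degIn
  rw [Finset.card_filter, Finset.sum_product]
  simp_rw [Finset.card_filter]

theorem adjPairs_mono {h G : SimpleGraph V} (hle : h ≤ G) {A A' B B' : Finset V} (hA : A ⊆ A')
    (hB : B ⊆ B') : adjPairs h A B ⊆ adjPairs G A' B' := by
  intro x hx
  obtain ⟨h1, h2, h3⟩ := mem_adjPairs.1 hx
  exact mem_adjPairs.2 ⟨hA h1, hB h2, hle h3⟩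

theorem mul_card_le_card_adjPairs {h : SimpleGraph V} {A B : Finset V} {D : ℝ}
    (hD : ∀ v ∈ A, D ≤ degIn h B v) : D * A.card ≤ (adjPairs h A B).card := by
  rw [card_adjPairs]
  push_cast
  calc D * A.card = ∑ _a ∈ A, D := by simp [mul_comm]
    _ ≤ _ := Finset.sum_le_sum hD

theorem card_adjPairs_le_mul_card {h : SimpleGraph V} {A B : Finset V} {D : ℝ}
    (hD : ∀ v ∈ A, (degIn h B v : ℝ) ≤ D) : ((adjPairs h A B).card : ℝ) ≤ D * A.card := by
  rw [card_adjPairs]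
  push_cast
  calc _ ≤ ∑ _a ∈ A, D := Finset.sum_le_sum hD
    _ = D * A.card := by simp [mul_comm]

theorem card_adjPairs_insert (h : SimpleGraph V) {W : Finset V} {v : V} (hv : v ∉ W) :
    (adjPairs h (insert v W) (insert v W)).card = (adjPairs h W W).card + 2 * degIn h W v := by
  have h1 : ∀ a, degIn h (insert v W) a = degIn h W a + if h.Adj a v then 1 else 0 := by
    intro a
    unfold degIn
    rw [Finset.filter_insert]
    split_ifs with hav
    · rw [Finset.card_insert_of_notMem (by simp [hv])]
    · rfl
  rw [card_adjPairs, card_adjPairs, Finset.sum_insert hv]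
  simp_rw [h1]
  rw [Finset.sum_add_distrib, ← Finset.card_filter]
  have h2 : (W.filter fun a => h.Adj a v).card = degIn h W v := by
    unfold degIn
    simp_rw [SimpleGraph.adj_comm h v]
  rw [h2]
  simp
  ring

/-- All but at most `μ` of the ordered adjacent pairs of `G` within `W` are adjacent in `h`. -/
def AlmostInduced (G h : SimpleGraph V) (W : Finset V) (μ : ℝ) : Prop :=
  ((adjPairs G W W \ adjPairs h W W).card : ℝ) ≤ μ

theorem AlmostInduced.card_adjPairs_le {G h : SimpleGraph V} {W : Finset V} {μ : ℝ}
    (hm : AlmostInduced G h W μ) {A B : Finset V} (hA : A ⊆ W) (hB : B ⊆ W) :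
    ((adjPairs G A B).card : ℝ) ≤ (adjPairs h A B).card + μ := by
  have h1 : adjPairs G A B ⊆ adjPairs h A B ∪ (adjPairs G W W \ adjPairs h W W) := by
    intro x hx
    obtain ⟨h1, h2, h3⟩ := mem_adjPairs.1 hx
    by_cases h4 : h.Adj x.1 x.2
    · exact Finset.mem_union_left _ (mem_adjPairs.2 ⟨h1, h2, h4⟩)
    · exact Finset.mem_union_right _ (Finset.mem_sdiff.2 ⟨mem_adjPairs.2 ⟨hA h1, hB h2, h3⟩,
        fun h5 => h4 (mem_adjPairs.1 h5).2.2⟩)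
  have h2 := (Finset.card_le_card h1).trans (Finset.card_union_le _ _)
  have h3 : ((adjPairs G A B).card : ℝ) ≤ (adjPairs h A B).card +
      (adjPairs G W W \ adjPairs h W W).card := by exact_mod_cast h2
  have h4 : ((adjPairs G W W \ adjPairs h W W).card : ℝ) ≤ μ := hm
  linarith

theorem AlmostInduced.graphOn {G h : SimpleGraph V} {W W' : Finset V} {μ : ℝ}
    (hm : AlmostInduced G h W μ) (hW : W' ⊆ W) : AlmostInduced G (graphOn h W') W' μ := by
  have h1 : adjPairs G W' W' \ adjPairs (_root_.graphOn h W') W' W' ⊆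
      adjPairs G W W \ adjPairs h W W := by
    intro x hx
    obtain ⟨h1, h2⟩ := Finset.mem_sdiff.1 hx
    obtain ⟨h3, h4, h5⟩ := mem_adjPairs.1 h1
    exact Finset.mem_sdiff.2 ⟨mem_adjPairs.2 ⟨hW h3, hW h4, h5⟩,
      fun h6 => h2 (mem_adjPairs.2 ⟨h3, h4, (mem_adjPairs.1 h6).2.2, h3, h4⟩)⟩
  have h2 : ((adjPairs G W' W' \ adjPairs (_root_.graphOn h W') W' W').card : ℝ) ≤
      (adjPairs G W W \ adjPairs h W W).card := by exact_mod_cast Finset.card_le_card h1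
  exact h2.trans hm

theorem degIn_graphOn (h : SimpleGraph V) {W : Finset V} {v : V} (hv : v ∈ W) :
    degIn (graphOn h W) W v = degIn h W v := by
  unfold degIn
  congr 1
  refine Finset.filter_congr fun w hw => ?_
  exact ⟨fun h => h.1, fun h => ⟨h, hv, hw⟩⟩

variable [Fintype V]

theorem DenseBetween.mul_sq_le {G h : SimpleGraph V} {p δ μ : ℝ} (hG : DenseBetween G p δ)
    (hp : 0 ≤ p) (hδ : 0 ≤ δ) {W : Finset V} (hm : AlmostInduced G h W μ) {A B : Finset V}
    (hA : A ⊆ W) (hB : B ⊆ W) (hAB : Disjoint A B) (hAc : δ * Fintype.card V ≤ A.card)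
    (hBc : δ * Fintype.card V ≤ B.card) :
    p * (δ * Fintype.card V) ^ 2 / 4 - μ ≤ (adjPairs h A B).card := by
  have h1 := hG A B hAB hAc hBc
  have h2 := hm.card_adjPairs_le hA hB
  have h3 : p * (δ * Fintype.card V) ^ 2 ≤ p * A.card * B.card := by
    rw [mul_assoc, sq]; gcongr
  linarith

theorem DenseBetween.joinedOn {G h : SimpleGraph V} {p δ μ : ℝ} (hG : DenseBetween G p δ)
    (hp : 0 ≤ p) (hδ : 0 ≤ δ) {W : Finset V} (hm : AlmostInduced G h W μ)
    (hμ : μ < p * (δ * Fintype.card V) ^ 2 / 4) : JoinedOn h W (δ * Fintype.card V) := by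
  intro A hA B hB hAB hAc hBc
  have h1 := hG.mul_sq_le hp hδ hm hA hB hAB hAc hBc
  have h2 : 0 < (adjPairs h A B).card := by
    have : (0 : ℝ) < (adjPairs h A B).card := by linarith
    exact_mod_cast this
  obtain ⟨x, hx⟩ := Finset.card_pos.1 h2
  obtain ⟨h3, h4, h5⟩ := mem_adjPairs.1 hx
  exact ⟨_, h3, _, h4, h5⟩

/-- Small sets expand, since otherwise a small set would contain too many edges. -/
theorem LocallySparse.expansion {G h : SimpleGraph V} {p θ γ D : ℝ} (hG : LocallySparse G p θ γ)
    (hle : h ≤ G) {W : Finset V} (hD : ∀ v ∈ W, D ≤ degIn h W v) {K : ℕ} (hθ : 0 ≤ θ) (hp : 0 ≤ p)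
    (hK : 2 * θ * Fintype.card V * p * (K + 1) < D) {A : Finset V} (hA : A ⊆ W)
    (hne : A.Nonempty) (hAc : (K + 1) * (A.card : ℝ) ≤ γ * Fintype.card V) :
    K * A.card < (outerNbhd (graphOn h W) A).card := by
  by_contra hcon
  rw [not_lt] at hcon
  set S := A ∪ outerNbhd (graphOn h W) A with hS
  have hSc : (S.card : ℝ) ≤ (K + 1) * A.card := by
    have : S.card ≤ (K + 1) * A.card := by
      have := Finset.card_union_le A (outerNbhd (graphOn h W) A)
      rw [hS]; linarith
    exact_mod_cast this
  have h1 := hG S (hSc.trans hAc)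
  have h2 : adjPairs h A W ⊆ adjPairs G S S := by
    intro x hx
    obtain ⟨h1, h2, h3⟩ := mem_adjPairs.1 hx
    refine mem_adjPairs.2 ⟨Finset.mem_union_left _ h1, ?_, hle h3⟩
    by_cases h4 : x.2 ∈ A
    · exact Finset.mem_union_left _ h4
    · exact Finset.mem_union_right _ (mem_outerNbhd.2 ⟨h4, x.1, h1, h3, hA h1, h2⟩)
  have h3 : ((adjPairs h A W).card : ℝ) ≤ (adjPairs G S S).card := by
    exact_mod_cast Finset.card_le_card h2
  have h4 : D * A.card ≤ (adjPairs h A W).card :=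
    mul_card_le_card_adjPairs fun v hv => hD v (hA hv)
  have hA0 : (0 : ℝ) < A.card := by exact_mod_cast hne.card_pos
  have h5 : 2 * θ * Fintype.card V * p * S.card ≤
      2 * θ * Fintype.card V * p * ((K + 1) * A.card) := by gcongr
  nlinarith

/-- `h` has subgraphs induced on vertex sets of any prescribed linear size `ℓ` whose minimum degree
is still of order `n p`. A set `W'` of at most `ℓ` vertices maximising `e(W') - D' |W'|` works: its
degrees are at least `D'` since no vertex can be removed, and if it had fewer than `ℓ` vertices
then no vertex of the remainder `W \ W'` could be added, so the remainder would send too few edges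
to `W'` (if it is large) or span too many (if it is small). -/
theorem exists_subset_minDegree {G h : SimpleGraph V} {p β δ γ₁ θ γ D D' μ : ℝ} (hp : 0 ≤ p)
    (hle : h ≤ G) {W : Finset V} (hm : AlmostInduced G h W μ)
    (hdeg : ∀ v ∈ W, D ≤ degIn h W v)
    (hdense : DenseBetween G p δ) (hsp₁ : LocallySparse G p 1 γ₁) (hsp : LocallySparse G p θ γ)
    (hδ : 0 ≤ δ) (hβδ : δ ≤ β / 4) (hδ₁ : δ ≤ γ₁) (hδγ : δ ≤ γ) (hD' : 0 ≤ D')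
    -- the subset found has more than `γ₁ n` vertices
    (h1 : p * (γ₁ * Fintype.card V) * 2 * Fintype.card V + μ + 2 * D' * Fintype.card V <
      p * (β / 4 * Fintype.card V) ^ 2 / 4)
    -- large remainders
    (h2 : (D' - p * (γ₁ * Fintype.card V) / 4) * (δ * Fintype.card V) + μ < 0)
    (h2' : D' ≤ p * (γ₁ * Fintype.card V) / 4)
    -- small remainders
    (h3 : 2 * θ * Fintype.card V * p < D - D')
    {ℓ : ℕ} (hℓ : 2 ≤ ℓ) (hβ : β * Fintype.card V ≤ ℓ) (hℓW : ℓ ≤ W.card) :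
    ∃ W' ⊆ W, W'.card = ℓ ∧ ∀ v ∈ W', D' ≤ degIn h W' v := by
  set n : ℝ := ((Fintype.card V : ℕ) : ℝ) with hn
  have hn0 : 0 ≤ n := Nat.cast_nonneg _
  let φ : Finset V → ℝ := fun Z => (adjPairs h Z Z).card - 2 * D' * Z.card
  obtain ⟨W0, hW0, hW0c⟩ := Finset.exists_subset_card_eq hℓW
  obtain ⟨W', hW', hmax⟩ := Finset.exists_max_image
    (W.powerset.filter fun Z => Z.card ≤ ℓ) φ
    ⟨W0, Finset.mem_filter.2 ⟨Finset.mem_powerset.2 hW0, hW0c.le⟩⟩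
  rw [Finset.mem_filter, Finset.mem_powerset] at hW'
  obtain ⟨hW'W, hW'c⟩ := hW'
  have hφ0 : φ W0 ≤ φ W' := hmax W0 (Finset.mem_filter.2 ⟨Finset.mem_powerset.2 hW0, hW0c.le⟩)
  have hφi : ∀ Z : Finset V, ∀ v ∉ Z, φ (insert v Z) = φ Z + 2 * (degIn h Z v - D') := by
    intro Z v hv
    simp only [φ]
    rw [card_adjPairs_insert h hv, Finset.card_insert_of_notMem hv]
    push_cast; ring
  refine ⟨W', hW'W, ?_, ?_⟩
  · by_contra hne
    have hlt : W'.card < ℓ := lt_of_le_of_ne hW'c hne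
    set X := W \ W' with hX
    have hXne : X.Nonempty := by
      rw [← Finset.card_pos, hX, Finset.card_sdiff_of_subset hW'W]
      omega
    have hXdeg : ∀ v ∈ X, (degIn h W' v : ℝ) ≤ D' := by
      intro v hv
      obtain ⟨hvW, hvW'⟩ := Finset.mem_sdiff.1 hv
      have h4 := hmax (insert v W') (Finset.mem_filter.2 ⟨Finset.mem_powerset.2
        (Finset.insert_subset hvW hW'W), by rw [Finset.card_insert_of_notMem hvW']; omega⟩)
      rw [hφi W' v hvW'] at h4
      linarith
    -- `W'` is large
    have hbig : γ₁ * n < W'.card := by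
      by_contra hsmall
      have h4 := hsp₁ W' (not_lt.1 hsmall)
      obtain ⟨A, hA, hAc⟩ : ∃ A ⊆ W0, A.card = ℓ / 2 :=
        Finset.exists_subset_card_eq (by omega)
      have hhalf : β / 4 * n ≤ (ℓ / 2 : ℕ) := by
        have : (ℓ : ℝ) ≤ 4 * (ℓ / 2 : ℕ) := by
          have : ℓ ≤ 4 * (ℓ / 2) := by omega
          exact_mod_cast this
        linarith
      have hBc : β / 4 * n ≤ (W0 \ A).card := by
        refine hhalf.trans ?_
        have : ℓ / 2 ≤ (W0 \ A).card := by
          rw [Finset.card_sdiff_of_subset hA]; omega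
        exact_mod_cast this
      rw [← hAc] at hhalf
      have h5 := hdense A (W0 \ A) Finset.disjoint_sdiff
        (le_trans (by gcongr) hhalf) (le_trans (by gcongr) hBc)
      have h6 := hm.card_adjPairs_le (hA.trans hW0) (Finset.sdiff_subset (t := A).trans hW0)
      have h7 : ((adjPairs h A (W0 \ A)).card : ℝ) ≤ (adjPairs h W0 W0).card := by
        exact_mod_cast Finset.card_le_card (adjPairs_mono le_rfl hA Finset.sdiff_subset)
      have hβ0 : 0 ≤ β / 4 := hδ.trans hβδ
      have h8 : p * (β / 4 * n) ^ 2 ≤ p * A.card * (W0 \ A).card := by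
        rw [mul_assoc, sq]; gcongr
      have h9 : ((adjPairs h W' W').card : ℝ) ≤ (adjPairs G W' W').card := by
        exact_mod_cast Finset.card_le_card (adjPairs_mono hle le_rfl le_rfl)
      have h10 : 2 * D' * W0.card ≤ 2 * D' * n := by
        gcongr
        rw [hn]; exact_mod_cast Finset.card_le_univ W0
      have h11 : (0 : ℝ) ≤ 2 * D' * W'.card := by positivity
      have h12 : 2 * 1 * n * p * W'.card ≤ 2 * 1 * n * p * (γ₁ * n) := by
        gcongr; exact not_lt.1 hsmall
      simp only [φ] at hφ0
      linarith
    by_cases hXδ : δ * n ≤ X.card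
    · have h4 := hdense X W' Finset.sdiff_disjoint hXδ (le_trans (by gcongr) hbig.le)
      have h5 := hm.card_adjPairs_le (A := X) Finset.sdiff_subset hW'W
      have h6 := card_adjPairs_le_mul_card hXdeg
      have h7 : p * X.card * (γ₁ * n) ≤ p * X.card * W'.card := by gcongr
      have h8 : (D' - p * (γ₁ * n) / 4) * X.card ≤ (D' - p * (γ₁ * n) / 4) * (δ * n) :=
        mul_le_mul_of_nonpos_left hXδ (by linarith)
      nlinarith
    · have h4 := hsp X ((not_le.1 hXδ).le.trans (by gcongr))
      have h5 : ((adjPairs h X X).card : ℝ) ≤ (adjPairs G X X).card := by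
        exact_mod_cast Finset.card_le_card (adjPairs_mono hle le_rfl le_rfl)
      have h6 : (D - D') * X.card ≤ (adjPairs h X X).card := by
        refine mul_card_le_card_adjPairs fun v hv => ?_
        have h7 := hdeg v (Finset.sdiff_subset hv)
        have h8 := hXdeg v hv
        have h9 : degIn h W v ≤ degIn h X v + degIn h W' v := by
          unfold degIn
          refine (Finset.card_le_card ?_).trans (Finset.card_union_le _ _)
          rw [← Finset.filter_union, hX, Finset.sdiff_union_of_subset hW'W]
        have h10 : (degIn h W v : ℝ) ≤ degIn h X v + degIn h W' v := by exact_mod_cast h9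
        linarith
      have hX0 : (0 : ℝ) < X.card := by exact_mod_cast hXne.card_pos
      have := mul_lt_mul_of_pos_right h3 hX0
      linarith
  · intro v hv
    have h4 := hφi (W'.erase v) v (Finset.notMem_erase v W')
    rw [Finset.insert_erase hv] at h4
    have h5 := hmax (W'.erase v) (Finset.mem_filter.2 ⟨Finset.mem_powerset.2
      ((Finset.erase_subset _ _).trans hW'W), (Finset.card_erase_le).trans hW'c⟩)
    have h6 : degIn h (W'.erase v) v ≤ degIn h W' v :=
      Finset.card_le_card (Finset.filter_subset_filter _ (Finset.erase_subset _ _))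
    have h7 : (degIn h (W'.erase v) v : ℝ) ≤ degIn h W' v := by exact_mod_cast h6
    linarith
end

/-! ### Sparse expanders and boosters -/

section
open scoped Classical

/-- Greedy hitting sets: when the sets of a family each contain a proportion at least `M / m` of
the ground set, `k` greedily chosen points miss at most a proportion `(1 - M / m) ^ k` of
the family. -/
theorem exists_hitting_set {α : Type*} (E : Finset α) (𝓢 : Finset (Finset α)) {M m : ℝ}
    (hM : 0 < M) (hMm : M ≤ m) (hE : (E.card : ℝ) ≤ m) (h𝓢 : ∀ S ∈ 𝓢, S ⊆ E ∧ M ≤ S.card) (k : ℕ) :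
    ∃ T ⊆ E, T.card ≤ k ∧
      ((𝓢.filter fun S => Disjoint S T).card : ℝ) ≤ 𝓢.card * (1 - M / m) ^ k := by
  have hm : 0 < m := hM.trans_le hMm
  have hq : 0 ≤ 1 - M / m := sub_nonneg.2 ((div_le_one hm).2 hMm)
  induction k with
  | zero => exact ⟨∅, by simp, by simp, by simp⟩
  | succ k ih =>
    obtain ⟨T, hTE, hTk, hT⟩ := ih
    set 𝓢' := 𝓢.filter fun S => Disjoint S T with h𝓢'
    rcases 𝓢'.eq_empty_or_nonempty with h0 | ⟨S0, hS0⟩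
    · refine ⟨T, hTE, by omega, ?_⟩
      rw [← h𝓢', h0]
      simp only [Finset.card_empty, Nat.cast_zero]
      positivity
    have hsub : ∀ S ∈ 𝓢', S ⊆ E ∧ M ≤ S.card := fun S hS => h𝓢 S (Finset.mem_filter.1 hS).1
    have hEne : E.Nonempty := by
      obtain ⟨h1, h2⟩ := hsub S0 hS0
      have : (0 : ℝ) < S0.card := hM.trans_le h2
      exact (Finset.card_pos.1 (by exact_mod_cast this)).mono h1
    obtain ⟨e, he, hemax⟩ : ∃ e ∈ E, M * 𝓢'.card / m ≤ ((𝓢'.filter fun S => e ∈ S).card : ℝ) := by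
      apply Finset.exists_le_of_sum_le hEne
      have h1 : ∑ e ∈ E, ((𝓢'.filter fun S => e ∈ S).card : ℝ) = ∑ S ∈ 𝓢', (S.card : ℝ) := by
        simp_rw [Finset.card_filter]
        push_cast
        rw [Finset.sum_comm]
        refine Finset.sum_congr rfl fun S hS => ?_
        rw [Finset.sum_ite_mem, Finset.inter_eq_right.2 (hsub S hS).1]
        simp
      rw [h1, Finset.sum_const, nsmul_eq_mul]
      calc (E.card : ℝ) * (M * 𝓢'.card / m) ≤ m * (M * 𝓢'.card / m) := by gcongr
        _ = ∑ _S ∈ 𝓢', M := by rw [Finset.sum_const, nsmul_eq_mul]; field_simp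
        _ ≤ _ := Finset.sum_le_sum fun S hS => (hsub S hS).2
    refine ⟨insert e T, Finset.insert_subset he hTE, (Finset.card_insert_le _ _).trans (by omega),
      ?_⟩
    have h2 : (𝓢.filter fun S => Disjoint S (insert e T)) ⊆ 𝓢'.filter fun S => ¬ e ∈ S := by
      intro S hS
      obtain ⟨h3, h4⟩ := Finset.mem_filter.1 hS
      rw [Finset.disjoint_insert_right] at h4
      exact Finset.mem_filter.2 ⟨Finset.mem_filter.2 ⟨h3, h4.2⟩, h4.1⟩
    have h3 := Finset.card_filter_add_card_filter_not (s := 𝓢') (fun S => e ∈ S)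
    have h4 : ((𝓢'.filter fun S => e ∈ S).card : ℝ) + (𝓢'.filter fun S => ¬ e ∈ S).card =
        𝓢'.card := by exact_mod_cast h3
    have h5 : ((𝓢.filter fun S => Disjoint S (insert e T)).card : ℝ) ≤
        (𝓢'.filter fun S => ¬ e ∈ S).card := by exact_mod_cast Finset.card_le_card h2
    calc _ ≤ (𝓢'.card : ℝ) * (1 - M / m) := by
          have : M * 𝓢'.card / m = 𝓢'.card * (M / m) := by ring
          linarith
      _ ≤ 𝓢.card * (1 - M / m) ^ k * (1 - M / m) := by gcongr
      _ = _ := by ring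

theorem exists_hitting_set_of_lt_one {α : Type*} (E : Finset α) (𝓢 : Finset (Finset α)) {M m : ℝ}
    (hM : 0 < M) (hMm : M ≤ m) (hE : (E.card : ℝ) ≤ m) (h𝓢 : ∀ S ∈ 𝓢, S ⊆ E ∧ M ≤ S.card) {k : ℕ}
    (hk : 𝓢.card * (1 - M / m) ^ k < 1) :
    ∃ T ⊆ E, T.card ≤ k ∧ ∀ S ∈ 𝓢, ∃ x ∈ S, x ∈ T := by
  obtain ⟨T, hT, hTk, hmiss⟩ := exists_hitting_set E 𝓢 hM hMm hE h𝓢 k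
  refine ⟨T, hT, hTk, fun S hS => ?_⟩
  have h1 : ((𝓢.filter fun S => Disjoint S T).card : ℝ) < 1 := hmiss.trans_lt hk
  have h2 : (𝓢.filter fun S => Disjoint S T) = ∅ := by
    rw [← Finset.card_eq_zero]
    have : (𝓢.filter fun S => Disjoint S T).card < 1 := by exact_mod_cast h1
    omega
  refine Finset.not_disjoint_iff.1 fun h4 => ?_
  have : S ∈ 𝓢.filter fun S => Disjoint S T := Finset.mem_filter.2 ⟨hS, h4⟩
  rw [h2] at this
  simp at this

variable {V : Type*} [Fintype V]

theorem outerNbhd_mono {Γ Γ' : SimpleGraph V} (h : Γ ≤ Γ') (A : Finset V) :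
    outerNbhd Γ A ⊆ outerNbhd Γ' A := by
  intro v hv
  obtain ⟨h1, a, h2, h3⟩ := mem_outerNbhd.1 hv
  exact mem_outerNbhd.2 ⟨h1, a, h2, h h3⟩

/-- A hitting set of at most `k` edges for the at most `4 ^ n` sets of edges between two disjoint
large sets of vertices. -/
theorem exists_sparse_joined [Nonempty V] {h : SimpleGraph V} {W : Finset V} {d M m : ℝ} (hM : 0 < M)
    (hMm : M ≤ m) (hm : ((adjPairs h W W).card : ℝ) ≤ m)
    (hdense : ∀ A ⊆ W, ∀ B ⊆ W, Disjoint A B → d ≤ A.card → d ≤ B.card →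
      M ≤ (adjPairs h A B).card) {k : ℕ} (hk : 3 * Fintype.card V * m ≤ k * M) :
    ∃ T ⊆ adjPairs h W W, T.card ≤ k ∧ ∀ A ⊆ W, ∀ B ⊆ W, Disjoint A B → d ≤ A.card →
      d ≤ B.card → ∃ x ∈ T, x.1 ∈ A ∧ x.2 ∈ B := by
  have hm0 : 0 < m := hM.trans_le hMm
  set I : Finset (Finset V × Finset V) := Finset.univ.filter fun x =>
    x.1 ⊆ W ∧ x.2 ⊆ W ∧ Disjoint x.1 x.2 ∧ d ≤ x.1.card ∧ d ≤ x.2.card with hI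
  set 𝓢 := I.image fun x => adjPairs h x.1 x.2 with h𝓢
  have hmem : ∀ S ∈ 𝓢, S ⊆ adjPairs h W W ∧ M ≤ S.card := by
    intro S hS
    obtain ⟨x, hx, rfl⟩ := Finset.mem_image.1 hS
    obtain ⟨h1, h2, h3, h4, h5⟩ := (Finset.mem_filter.1 hx).2
    exact ⟨adjPairs_mono le_rfl h1 h2, hdense _ h1 _ h2 h3 h4 h5⟩
  have hlt : (𝓢.card : ℝ) * (1 - M / m) ^ k < 1 := by
    have hn : (0 : ℝ) < Fintype.card V := by exact_mod_cast Fintype.card_pos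
    have h1 : (𝓢.card : ℝ) ≤ 4 ^ Fintype.card V := by
      have : 𝓢.card ≤ 4 ^ Fintype.card V := by
        refine Finset.card_image_le.trans ((Finset.card_le_univ I).trans (le_of_eq ?_))
        rw [Fintype.card_prod, Fintype.card_finset, ← mul_pow]
        norm_num
      exact_mod_cast this
    have h2 := four_pow_le_exp (Fintype.card V)
    have hq : 0 ≤ 1 - M / m := sub_nonneg.2 ((div_le_one hm0).2 hMm)
    have h3 : (1 - M / m) ^ k ≤ Real.exp (-(3 * Fintype.card V)) := by
      calc (1 - M / m) ^ k ≤ Real.exp (-(M / m)) ^ k := by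
            gcongr
            linarith [Real.add_one_le_exp (-(M / m))]
        _ = Real.exp (-(k * M / m)) := by rw [← Real.exp_nat_mul]; ring_nf
        _ ≤ _ := by
            apply Real.exp_le_exp.2
            rw [neg_le_neg_iff, le_div_iff₀ hm0]
            exact hk
    calc (𝓢.card : ℝ) * (1 - M / m) ^ k
        ≤ Real.exp (2 * Fintype.card V) * Real.exp (-(3 * Fintype.card V)) := by
          gcongr
          exact h1.trans h2
      _ = Real.exp (-Fintype.card V) := by rw [← Real.exp_add]; ring_nf
      _ < 1 := by
          rw [Real.exp_lt_one_iff]; linarith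
  obtain ⟨T, hT, hTk, hhit⟩ := exists_hitting_set_of_lt_one (adjPairs h W W) 𝓢 hM hMm hm hmem hlt
  refine ⟨T, hT, hTk, fun A hA B hB hAB hAc hBc => ?_⟩
  have hpair : (A, B) ∈ I := Finset.mem_filter.2 ⟨Finset.mem_univ _, hA, hB, hAB, hAc, hBc⟩
  obtain ⟨x, hx1, hx2⟩ := hhit _ (Finset.mem_image_of_mem _ hpair)
  obtain ⟨h4, h5, -⟩ := mem_adjPairs.1 hx1
  exact ⟨x, hx2, h4, h5⟩

theorem connectedOn_of_joinedOn {Γ : SimpleGraph V} {W : Finset V} {d : ℝ}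
    (hΓ : ∀ a b, Γ.Adj a b → a ∈ W) (hj : JoinedOn Γ W d) (hd : 5 * d ≤ W.card)
    (hexp : ∀ A ⊆ W, A.Nonempty → 5 * A.card ≤ W.card → 2 * A.card < (outerNbhd Γ A).card) :
    ConnectedOn Γ W := by
  intro A hA hne hAW
  have hZne : (W \ A).Nonempty := by
    rw [Finset.sdiff_nonempty]
    exact fun h => hAW (Finset.Subset.antisymm hA h)
  have hN : ∀ A ⊆ W, A.Nonempty → 5 * A.card ≤ W.card → ∃ a ∈ A, ∃ b ∈ W, b ∉ A ∧ Γ.Adj a b := by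
    intro A hA hne h5
    have := hexp A hA hne h5
    obtain ⟨v, hv⟩ := Finset.card_pos.1 (show 0 < (outerNbhd Γ A).card by omega)
    obtain ⟨h1, a, h2, h3⟩ := mem_outerNbhd.1 hv
    exact ⟨a, h2, v, hΓ _ _ h3.symm, h1, h3⟩
  by_cases h1 : 5 * A.card ≤ W.card
  · exact hN A hA hne h1
  by_cases h2 : 5 * (W \ A).card ≤ W.card
  · obtain ⟨a, ha, b, hb, hbA, hab⟩ := hN _ Finset.sdiff_subset hZne h2
    have hb' : b ∈ A := by
      by_contra h
      exact hbA (Finset.mem_sdiff.2 ⟨hb, h⟩)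
    exact ⟨b, hb', a, (Finset.mem_sdiff.1 ha).1, (Finset.mem_sdiff.1 ha).2, hab.symm⟩
  · have e1 : (W.card : ℝ) < 5 * A.card := by exact_mod_cast not_le.1 h1
    have e2 : (W.card : ℝ) < 5 * (W \ A).card := by exact_mod_cast not_le.1 h2
    obtain ⟨a, ha, b, hb, hab⟩ := hj A hA (W \ A) Finset.sdiff_subset Finset.disjoint_sdiff
      (by linarith) (by linarith)
    exact ⟨a, ha, b, (Finset.mem_sdiff.1 hb).1, (Finset.mem_sdiff.1 hb).2, hab⟩

/-- `h` contains an expanding connected spanning subgraph with few edges: `r` edges at every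
vertex take care of small sets, a hitting set of the edges between large sets of the others. -/
theorem exists_sparse_expander [Nonempty V] {G h : SimpleGraph V} {p δ θ γ m : ℝ} (hp : 0 ≤ p)
    (hle : h ≤ G) {W : Finset V} (hh : ∀ a b, h.Adj a b → a ∈ W) {r k : ℕ}
    (hdeg : ∀ v ∈ W, r ≤ degIn h W v) (hsp : LocallySparse G p θ γ) (hθ : 0 ≤ θ)
    (hr : 6 * θ * Fintype.card V * p < r) (hδ : 3 * δ ≤ γ)
    (hW : 5 * (δ * Fintype.card V) < W.card) {M : ℝ} (hM : 0 < M)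
    (hMm : M ≤ m) (hm : ((adjPairs h W W).card : ℝ) ≤ m)
    (hdense : ∀ A ⊆ W, ∀ B ⊆ W, Disjoint A B → δ * Fintype.card V ≤ A.card →
      δ * Fintype.card V ≤ B.card → M ≤ (adjPairs h A B).card)
    (hk : 3 * Fintype.card V * m ≤ k * M) :
    ∃ Γ ≤ h, Γ.edgeFinset.card ≤ Fintype.card V * r + k ∧ ConnectedOn Γ W ∧
      ∀ A ⊆ W, A.Nonempty → 5 * A.card ≤ W.card → 2 * A.card < (outerNbhd Γ A).card := by
  set n : ℝ := ((Fintype.card V : ℕ) : ℝ) with hn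
  obtain ⟨T2, hT2, hT2k, hT2j⟩ := exists_sparse_joined hM hMm hm hdense hk
  have hc : ∀ v : V, ∃ c ⊆ W.filter (h.Adj v), v ∈ W → c.card = r := by
    intro v
    by_cases hv : v ∈ W
    · obtain ⟨c, hc, hcr⟩ := Finset.exists_subset_card_eq (hdeg v hv)
      exact ⟨c, hc, fun _ => hcr⟩
    · exact ⟨∅, by simp, fun h => absurd h hv⟩
  choose c hcsub hccard using hc
  set T1 : Finset (V × V) := W.biUnion fun v => (c v).image fun w => (v, w) with hT1
  have hT1k : T1.card ≤ Fintype.card V * r := by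
    calc T1.card ≤ W.card * r := by
          refine Finset.card_biUnion_le_card_mul _ _ _ fun v hv => ?_
          exact Finset.card_image_le.trans (hccard v hv).le
      _ ≤ _ := Nat.mul_le_mul_right _ (Finset.card_le_univ _)
  have hTadj : ∀ x ∈ T1 ∪ T2, h.Adj x.1 x.2 := by
    intro x hx
    rcases Finset.mem_union.1 hx with hx | hx
    · obtain ⟨v, _, hx⟩ := Finset.mem_biUnion.1 hx
      obtain ⟨w, hw, rfl⟩ := Finset.mem_image.1 hx
      exact (Finset.mem_filter.1 (hcsub v hw)).2
    · exact (mem_adjPairs.1 (hT2 hx)).2.2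
  obtain ⟨Γ, hΓ⟩ : ∃ Γ : SimpleGraph V, Γ = SimpleGraph.fromRel fun a b => (a, b) ∈ T1 ∪ T2 :=
    ⟨_, rfl⟩
  have hΓadj : ∀ x ∈ T1 ∪ T2, Γ.Adj x.1 x.2 := fun x hx => by
    rw [hΓ, SimpleGraph.fromRel_adj]
    exact ⟨(hTadj x hx).ne, Or.inl hx⟩
  have hΓh : Γ ≤ h := by
    intro a b hab
    rw [hΓ, SimpleGraph.fromRel_adj] at hab
    rcases hab.2 with h1 | h1
    · exact hTadj _ h1
    · exact (hTadj _ h1).symm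
  have hΓW : ∀ a b, Γ.Adj a b → a ∈ W := fun a b hab => hh a b (hΓh hab)
  have hedges : Γ.edgeFinset.card ≤ Fintype.card V * r + k := by
    have h1 : Γ.edgeFinset ⊆ (T1 ∪ T2).image fun x => s(x.1, x.2) := by
      intro e
      induction e using Sym2.ind with
      | _ a b =>
        intro he
        rw [SimpleGraph.mem_edgeFinset, SimpleGraph.mem_edgeSet, hΓ, SimpleGraph.fromRel_adj] at he
        rcases he.2 with h1 | h1
        · exact Finset.mem_image.2 ⟨_, h1, rfl⟩
        · exact Finset.mem_image.2 ⟨_, h1, Sym2.eq_swap⟩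
    have h2 := ((Finset.card_le_card h1).trans Finset.card_image_le).trans
      (Finset.card_union_le T1 T2)
    omega
  have hjoin : JoinedOn Γ W (δ * n) := by
    intro A hA B hB hAB hAc hBc
    obtain ⟨x, hx, hxA, hxB⟩ := hT2j A hA B hB hAB hAc hBc
    exact ⟨_, hxA, _, hxB, hΓadj x (Finset.mem_union_right _ hx)⟩
  have hΓdeg : ∀ v ∈ W, (r : ℝ) ≤ degIn Γ W v := by
    intro v hv
    have : r ≤ degIn Γ W v := by
      rw [← hccard v hv]
      refine Finset.card_le_card fun w hw => ?_
      refine Finset.mem_filter.2 ⟨(Finset.mem_filter.1 (hcsub v hw)).1, ?_⟩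
      exact hΓadj (v, w) (Finset.mem_union_left _ (Finset.mem_biUnion.2
        ⟨v, hv, Finset.mem_image_of_mem _ hw⟩))
    exact_mod_cast this
  have hexp : ∀ A ⊆ W, A.Nonempty → 5 * A.card ≤ W.card → 2 * A.card < (outerNbhd Γ A).card := by
    intro A hA hne h5
    by_cases hsmall : 3 * (A.card : ℝ) ≤ γ * n
    · refine (hsp.expansion (hΓh.trans hle) hΓdeg (K := 2) hθ hp ?_ hA hne ?_).trans_le
        (Finset.card_le_card (outerNbhd_mono (graphOn_le _ _) A))
      · push_cast; linarith
      · push_cast; linarith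
    · have hAδ : δ * n ≤ A.card := by
        have : 3 * δ * n ≤ γ * n := by gcongr
        linarith
      have hR : ((W \ (A ∪ outerNbhd Γ A)).card : ℝ) < δ * n := by
        by_contra hcon
        obtain ⟨a, ha, b, hb, hab⟩ := hjoin A hA _ Finset.sdiff_subset
          (Finset.disjoint_left.2 fun x hx hx' => (Finset.mem_sdiff.1 hx').2 (by simp [hx])) hAδ
          (not_lt.1 hcon)
        obtain ⟨hbW, hb⟩ := Finset.mem_sdiff.1 hb
        rw [Finset.mem_union, not_or] at hb
        exact hb.2 (mem_outerNbhd.2 ⟨hb.1, a, ha, hab⟩)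
      have h1 : W.card ≤ (W \ (A ∪ outerNbhd Γ A)).card + (A.card + (outerNbhd Γ A).card) := by
        have h2 := Finset.le_card_sdiff (A ∪ outerNbhd Γ A) W
        have h3 := Finset.card_union_le A (outerNbhd Γ A)
        omega
      have h2 : (W.card : ℝ) ≤ (W \ (A ∪ outerNbhd Γ A)).card + (A.card + (outerNbhd Γ A).card) := by
        exact_mod_cast h1
      have h3 : 5 * (A.card : ℝ) ≤ W.card := by exact_mod_cast h5
      have h4 : 2 * (A.card : ℝ) < (outerNbhd Γ A).card := by linarith
      exact_mod_cast h4
  exact ⟨Γ, hΓh, hedges, connectedOn_of_joinedOn hΓW hjoin hW.le hexp, hexp⟩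

/-- The boosters of `Γ`: the non-edges joining the two ends of a longest path. -/
noncomputable def boosters (Γ : SimpleGraph V) : Finset (Sym2 V) :=
  ((longestPathEnds Γ).image fun x => s(x.1, x.2)) ∩
    ((⊤ : SimpleGraph V).edgeFinset \ Γ.edgeFinset)

theorem boosters_subset (Γ : SimpleGraph V) : boosters Γ ⊆ (⊤ : SimpleGraph V).edgeFinset :=
  Finset.inter_subset_right.trans Finset.sdiff_subset

theorem disjoint_edgeFinset_boosters (Γ : SimpleGraph V) : Disjoint Γ.edgeFinset (boosters Γ) :=
  Finset.disjoint_left.2 fun _ he he' =>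
    (Finset.mem_sdiff.1 (Finset.mem_inter.1 he').2).2 he

/-- A graph `h` that contains a sparse expander, and that misses few edges of `G`, contains
boosters of every slightly larger sparse subgraph. Adding them one at a time lengthens the longest
path until a cycle through all of `W` appears. -/
theorem exists_hamiltonian_cycle {G h Γ₀ : SimpleGraph V} {p η κ μ : ℝ} (hle : h ≤ G)
    {W : Finset V} (hh : ∀ a b, h.Adj a b → a ∈ W) (hm : AlmostInduced G h W μ)
    (hboost : DenseOnSparse G p η κ boosters) (hμ : μ < κ * p * (Fintype.card V : ℝ) ^ 2 / 4)
    (hΓ₀ : Γ₀ ≤ h) (hcon : ConnectedOn Γ₀ W)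
    (hexp : ∀ A ⊆ W, A.Nonempty → 5 * A.card ≤ W.card → 2 * A.card < (outerNbhd Γ₀ A).card)
    (hW : 5 ≤ W.card)
    (hκ : 2 * (κ * (Fintype.card V : ℝ) ^ 2) ≤ ((W.card / 5 : ℕ) : ℝ) ^ 2)
    (hη : (Γ₀.edgeFinset.card : ℝ) + Fintype.card V + 1 ≤ η * p * (Fintype.card V : ℝ) ^ 2) :
    ∃ l, IsCycleList h l ∧ l.toFinset = W := by
  by_contra hno
  -- `Γ` is `Γ₀` with at most `j` boosters added
  have main : ∀ j : ℕ, j ≤ Fintype.card V + 1 → ∃ Γ, Γ₀ ≤ Γ ∧ Γ ≤ h ∧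
      Γ.edgeFinset.card ≤ Γ₀.edgeFinset.card + j ∧ ∃ P, IsPathList Γ P ∧ j ≤ P.length := by
    intro j
    induction j with
    | zero =>
      exact fun _ => ⟨Γ₀, le_rfl, hΓ₀, by omega, [], ⟨by simp, by simp⟩, by simp⟩
    | succ j ih =>
      intro hj
      obtain ⟨Γ, h1, h2, h3, P₀, hP₀, hjP⟩ := ih (by omega)
      have hΓW : ∀ a b, Γ.Adj a b → a ∈ W := fun a b hab => hh a b (h2 hab)
      have hΓcon : ConnectedOn Γ W := by
        intro A hA hne hAW
        obtain ⟨a, ha, b, hb, hbA, hab⟩ := hcon A hA hne hAW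
        exact ⟨a, ha, b, hb, hbA, h1 hab⟩
      have hΓexp : ∀ A ⊆ W, A.Nonempty → A.card ≤ W.card / 5 →
          2 * A.card < (outerNbhd Γ A).card := fun A hA hne hAc =>
        (hexp A hA hne (by omega)).trans_le (Finset.card_le_card (outerNbhd_mono h1 A))
      -- longest paths have at least three vertices
      obtain ⟨w, hw⟩ := Finset.card_pos.1 (show 0 < W.card by omega)
      have hw2 := hΓexp {w} (by simpa using hw) (by simp) (by simp; omega)
      rw [Finset.card_singleton] at hw2
      obtain ⟨x, hx, y, hy, hxy⟩ := Finset.one_lt_card.1 (show 1 < (outerNbhd Γ {w}).card by omega)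
      have hwx : Γ.Adj w x := by simpa using (mem_outerNbhd.1 hx).2
      have hwy : Γ.Adj w y := by simpa using (mem_outerNbhd.1 hy).2
      have hlen : ∀ P, IsLongestPath Γ P → 3 ≤ P.length := fun P hP =>
        hP.2 [x, w, y] ⟨by simp [hwx.symm, hwy], by simp [hwx.ne', hwy.ne, hxy]⟩
      have hsq := sq_le_card_longestPathEnds hΓW hwx hΓexp
      have hmem : ∀ z ∈ longestPathEnds Γ, s(z.1, z.2) ∈ boosters Γ := by
        intro z hz
        refine Finset.mem_inter.2 ⟨Finset.mem_image_of_mem _ hz, ?_⟩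
        obtain ⟨P, hP, hz1, hz2⟩ := (Finset.mem_filter.1 hz).2
        have hPlen := hlen P hP
        rw [Finset.mem_sdiff, SimpleGraph.mem_edgeFinset, SimpleGraph.mem_edgeFinset,
          SimpleGraph.mem_edgeSet, SimpleGraph.mem_edgeSet, SimpleGraph.top_adj]
        constructor
        · intro e
          rcases P with _ | ⟨a, P⟩
          · simp at hPlen
          · obtain rfl : a = z.1 := by simpa using hz1
            have hPne : P ≠ [] := by rintro rfl; simp at hPlen
            have : z.2 ∈ P := by
              refine List.mem_of_getLast? (l := P) ?_
              rcases P with _ | ⟨b, P⟩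
              · exact absurd rfl hPne
              · rwa [List.getLast?_cons_cons] at hz2
            exact (List.nodup_cons.1 hP.1.2).1 (e ▸ this)
        · intro hadj
          rcases longer_path_of_closing_edge le_rfl hΓW hΓcon hP.1 hPlen hz1 hz2 hadj with
            ⟨l, hl, hlW⟩ | ⟨P', hP', hP'len⟩
          · exact hno ⟨l, ⟨hl.1.mono h2, hl.2.1, fun a ha b hb => h2 (hl.2.2 a ha b hb)⟩, hlW⟩
          · have := hP.2 P' hP'
            omega
      have hcard : (longestPathEnds Γ).card ≤ 2 * (boosters Γ).card := by
        refine Finset.card_le_mul_card_image_of_maps_to hmem 2 fun e _ => ?_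
        induction e using Sym2.ind with
        | _ a b =>
          refine (Finset.card_le_card (t := {(a, b), (b, a)}) ?_).trans Finset.card_le_two
          rintro ⟨c, d⟩ h
          simpa using (Finset.mem_filter.1 h).2
      have hbig : κ * (Fintype.card V : ℝ) ^ 2 ≤ (boosters Γ).card := by
        have h4 : (((W.card / 5) ^ 2 : ℕ) : ℝ) ≤ (2 * (boosters Γ).card : ℕ) := by
          exact_mod_cast hsq.trans hcard
        push_cast at h4
        linarith
      have hsparse : (Γ.edgeFinset.card : ℝ) ≤ η * p * (Fintype.card V : ℝ) ^ 2 := by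
        have h4 : Γ.edgeFinset.card ≤ Γ₀.edgeFinset.card + Fintype.card V + 1 := by omega
        have h5 : (Γ.edgeFinset.card : ℝ) ≤ Γ₀.edgeFinset.card + Fintype.card V + 1 := by
          exact_mod_cast h4
        linarith
      have hG := hboost Γ (h2.trans hle) hsparse hbig
      -- some booster of `Γ` is an edge of `h`
      obtain ⟨z, hz, hzh⟩ : ∃ z ∈ longestPathEnds Γ, h.Adj z.1 z.2 := by
        by_contra! hnone
        have hsub : edgesIn G (boosters Γ) ⊆
            (adjPairs G W W \ adjPairs h W W).image fun x => s(x.1, x.2) := by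
          intro e he
          obtain ⟨he1, he2⟩ := Finset.mem_filter.1 he
          obtain ⟨z, hz, rfl⟩ := Finset.mem_image.1 (Finset.mem_inter.1 he1).1
          have hend : ∀ z ∈ longestPathEnds Γ, z.1 ∈ W := by
            intro z hz
            obtain ⟨P, hP, hz1, hz2⟩ := (Finset.mem_filter.1 hz).2
            have hPlen := hlen P hP
            rcases P with _ | ⟨a, _ | ⟨b, P⟩⟩
            · simp at hPlen
            · simp at hPlen
            · obtain rfl : a = z.1 := by simpa using hz1
              exact hΓW _ _ (List.isChain_cons_cons.1 hP.1.1).1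
          refine Finset.mem_image.2 ⟨z, Finset.mem_sdiff.2 ⟨mem_adjPairs.2 ⟨hend z hz,
            hend (z.2, z.1) (swap_mem_longestPathEnds hz), he2⟩, fun h4 => ?_⟩, rfl⟩
          exact hnone z hz (mem_adjPairs.1 h4).2.2
        have h4 := (Finset.card_le_card hsub).trans Finset.card_image_le
        have h5 : ((edgesIn G (boosters Γ)).card : ℝ) ≤
          (adjPairs G W W \ adjPairs h W W).card := by exact_mod_cast h4
        have h6 : ((adjPairs G W W \ adjPairs h W W).card : ℝ) ≤ μ := hm
        linarith
      obtain ⟨P, hP, hz1, hz2⟩ := (Finset.mem_filter.1 hz).2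
      obtain ⟨Γ', hΓ'⟩ : ∃ Γ' : SimpleGraph V, Γ' = Γ ⊔ SimpleGraph.edge z.1 z.2 := ⟨_, rfl⟩
      have hΓΓ' : Γ ≤ Γ' := hΓ' ▸ le_sup_left
      have hΓ'h : Γ' ≤ h := hΓ' ▸ sup_le h2 (by rw [SimpleGraph.edge_le_iff]; exact Or.inr hzh)
      have hΓ'adj : Γ'.Adj z.1 z.2 := by
        rw [hΓ', SimpleGraph.sup_adj, SimpleGraph.edge_adj]
        exact Or.inr ⟨Or.inl ⟨rfl, rfl⟩, hzh.ne⟩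
      have hΓ'c : Γ'.edgeFinset.card ≤ Γ.edgeFinset.card + 1 := by
        refine (Finset.card_le_card (t := insert s(z.1, z.2) Γ.edgeFinset) fun e => ?_).trans
          (Finset.card_insert_le _ _)
        induction e using Sym2.ind with
        | _ a b =>
          intro he
          rw [SimpleGraph.mem_edgeFinset, SimpleGraph.mem_edgeSet, hΓ', SimpleGraph.sup_adj,
            SimpleGraph.edge_adj] at he
          rcases he with he | he
          · exact Finset.mem_insert_of_mem (SimpleGraph.mem_edgeFinset.2 he)
          · exact Finset.mem_insert.2 (Or.inl (Sym2.eq_iff.2 he.1))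
      rcases longer_path_of_closing_edge hΓΓ' hΓW hΓcon hP.1 (hlen P hP) hz1 hz2 hΓ'adj with
        ⟨l, hl, hlW⟩ | ⟨P', hP', hP'len⟩
      · exact absurd ⟨l, ⟨hl.1.mono hΓ'h, hl.2.1, fun a ha b hb => hΓ'h (hl.2.2 a ha b hb)⟩, hlW⟩ hno
      · have := hP.2 P₀ hP₀
        exact ⟨Γ', h1.trans hΓΓ', hΓ'h, by omega, P', hP', by omega⟩
  obtain ⟨Γ, _, _, _, P, hP, hlen⟩ := main _ le_rfl
  have := hP.2.length_le_card
  omega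
end

/-! ### Long and short cycles in pseudorandom graphs -/

section
open scoped Classical
variable {V : Type*} [Fintype V]

theorem LocallySparse.mono {G : SimpleGraph V} {p θ γ γ' : ℝ} (h : LocallySparse G p θ γ)
    (hγ : γ' ≤ γ) : LocallySparse G p θ γ' :=
  fun S hS => h S (hS.trans (by gcongr))

/-- The sparse expander has `σ n p` edges at every vertex and a hitting set of `O(n / δ ^ 2)` edges,
few enough for `DenseOnSparse` to apply to it and to its extensions by at most `n` boosters. -/
theorem exists_hamiltonian_cycle_of_pseudorandom [Nonempty V] {G h : SimpleGraph V}
    {p α β γ δ ε η θ κ σ : ℝ} (hp : 0 < p) (hle : h ≤ G) {W : Finset V}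
    (hh : ∀ a b, h.Adj a b → a ∈ W)
    (hm : AlmostInduced G h W (ε * p * (Fintype.card V : ℝ) ^ 2))
    (hdeg : ∀ v ∈ W, α * Fintype.card V * p ≤ degIn h W v) (hW : β * Fintype.card V ≤ W.card)
    (hdense : DenseBetween G p δ) (hsp : LocallySparse G p θ γ)
    (hedges : ((adjPairs G Finset.univ Finset.univ).card : ℝ) ≤
      12 * p * (Fintype.card V : ℝ) ^ 2)
    (hboost : DenseOnSparse G p η κ boosters)
    (hδ : 0 < δ) (hδ1 : δ ≤ 1) (hδγ : 3 * δ ≤ γ) (hδβ : 5 * δ < β) (hε : ε ≤ δ ^ 2 / 8)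
    (hεκ : ε < κ / 4) (hκ : 200 * κ ≤ β ^ 2) (hθ : 0 ≤ θ) (hσα : σ ≤ α)
    (hθσ : 6 * θ < σ) (hση : 8 * σ ≤ η) (h1 : 1 ≤ σ * (p * Fintype.card V))
    (h2 : 8 ≤ η * (p * Fintype.card V)) (h3 : 1156 ≤ η * δ ^ 2 * (p * Fintype.card V))
    (h4 : 8 ≤ β * Fintype.card V) :
    ∃ l, IsCycleList h l ∧ l.toFinset = W := by
  have hn : (0 : ℝ) < Fintype.card V := by exact_mod_cast Fintype.card_pos
  have hn1 : (1 : ℝ) ≤ Fintype.card V := by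
    exact_mod_cast Nat.one_le_iff_ne_zero.2 Fintype.card_ne_zero
  set n : ℝ := ((Fintype.card V : ℕ) : ℝ) with hnd
  have hβ : 0 < β := by linarith
  have hσ : 0 < σ := by linarith
  set r : ℕ := ⌈σ * n * p⌉₊ with hr
  set k : ℕ := ⌈288 * n / δ ^ 2⌉₊ with hk
  have hr1 : σ * n * p ≤ r := Nat.le_ceil _
  have hr2 : (r : ℝ) < σ * n * p + 1 := Nat.ceil_lt_add_one (by positivity)
  have hk1 : 288 * n / δ ^ 2 ≤ k := Nat.le_ceil _
  have hk2 : (k : ℝ) < 288 * n / δ ^ 2 + 1 := Nat.ceil_lt_add_one (by positivity)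
  have hδ2 : δ ^ 2 ≤ 1 := by nlinarith
  obtain ⟨Γ, hΓh, hΓe, hΓc, hΓx⟩ := exists_sparse_expander (W := W) (r := r) (k := k)
    (m := 12 * p * n ^ 2) (M := p * (δ * n) ^ 2 / 8) hp.le hle hh (fun v hv => by
      apply Nat.ceil_le.2
      refine le_trans ?_ (hdeg v hv)
      gcongr) hsp hθ (by
      refine lt_of_lt_of_le ?_ hr1
      rw [← hnd]
      have : 6 * θ * (n * p) < σ * (n * p) := by gcongr
      linarith) hδγ (by
      rw [← hnd]
      have : 5 * δ * n < β * n := by gcongr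
      linarith) (by positivity) (by
      have : δ ^ 2 * (p * n ^ 2) ≤ 1 * (p * n ^ 2) := by gcongr
      have : 0 ≤ p * n ^ 2 := by positivity
      linarith) (le_trans (by
        exact_mod_cast Finset.card_le_card (adjPairs_mono hle (Finset.subset_univ _)
          (Finset.subset_univ _))) hedges) (by
      intro A hA B hB hAB hAc hBc
      refine le_trans ?_ (hdense.mul_sq_le hp.le hδ.le hm hA hB hAB hAc hBc)
      rw [← hnd]
      have : ε * (p * n ^ 2) ≤ δ ^ 2 / 8 * (p * n ^ 2) := by gcongr
      linarith) (by
      rw [← hnd]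
      rw [div_le_iff₀ (by positivity)] at hk1
      have : 288 * n * (p * n ^ 2 / 8) ≤ k * δ ^ 2 * (p * n ^ 2 / 8) := by gcongr
      linarith)
  have hW8 : (8 : ℝ) ≤ W.card := h4.trans hW
  have hW8' : 8 ≤ W.card := by exact_mod_cast hW8
  refine exists_hamiltonian_cycle hle hh hm hboost ?_ hΓh hΓc hΓx (by omega) ?_ ?_
  · rw [← hnd]
    have : ε * (p * n ^ 2) < κ / 4 * (p * n ^ 2) := by gcongr
    linarith
  · have h5 : (W.card : ℝ) ≤ 10 * (W.card / 5 : ℕ) := by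
      have : W.card ≤ 10 * (W.card / 5) := by omega
      exact_mod_cast this
    have h6 : (β * n / 10) ^ 2 ≤ ((W.card / 5 : ℕ) : ℝ) ^ 2 := by
      gcongr
      linarith
    rw [← hnd]
    have : 200 * κ * n ^ 2 ≤ β ^ 2 * n ^ 2 := by gcongr
    linarith
  · have h5 : (Γ.edgeFinset.card : ℝ) ≤ n * r + k := by
      rw [hnd]; exact_mod_cast hΓe
    rw [← hnd]
    have e1 : n * r ≤ η / 4 * (p * n ^ 2) := by
      have : (r : ℝ) ≤ 2 * (σ * n * p) := by linarith
      calc n * r ≤ n * (2 * (σ * n * p)) := by gcongr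
        _ = 8 * σ / 4 * (p * n ^ 2) := by ring
        _ ≤ _ := by gcongr
    have e2 : (k : ℝ) ≤ η / 4 * (p * n ^ 2) := by
      have e3 : (k : ℝ) ≤ 289 * n / δ ^ 2 := by
        have : 1 ≤ n / δ ^ 2 := by rw [le_div_iff₀ (by positivity)]; linarith
        have e4 : 289 * n / δ ^ 2 = 288 * n / δ ^ 2 + n / δ ^ 2 := by ring
        linarith
      refine e3.trans ?_
      rw [div_le_iff₀ (by positivity)]
      have : 1156 * n ≤ η * δ ^ 2 * (p * n) * n := by gcongr
      linarith
    have e3 : 8 * n ≤ η * (p * n) * n := by gcongr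
    linarith

/-- Cycles of all lengths from logarithmic to `β n`: an expanding part `W₂` of `W` holds the two
branchings, the rest of `W` the path. -/
theorem exists_short_cycle_of_pseudorandom [Nonempty V] {G h : SimpleGraph V}
    {p α β γ δ ε θ : ℝ} (hp : 0 < p) (hle : h ≤ G) {W W₂ : Finset V}
    (hm : AlmostInduced G h W (ε * p * (Fintype.card V : ℝ) ^ 2)) (hW₂ : W₂ ⊆ W)
    (hdeg : ∀ v ∈ W₂, α * Fintype.card V * p ≤ degIn h W₂ v)
    (hW₂c : β * Fintype.card V ≤ W₂.card) (hUc : 2 * β * Fintype.card V ≤ (W \ W₂).card)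
    (hdense : DenseBetween G p δ) (hsp : LocallySparse G p θ γ)
    (hδ : 0 < δ) (hδγ : 18 * δ ≤ γ) (hδβ : 4 * δ < β) (hδ1 : 2 * δ ≤ 1) (hε : ε < δ ^ 2 / 4)
    (hθ : 0 ≤ θ) (hθα : 18 * θ < α) (h1 : 1 ≤ δ * Fintype.card V)
    (h4 : 4 ≤ β * Fintype.card V)
    (h3 : 3 ≤ (Fintype.card V : ℝ)) {ℓ : ℕ} (hℓ : 6 * Real.log (Fintype.card V) ≤ ℓ)
    (hℓβ : ℓ ≤ β * Fintype.card V) :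
    ∃ l, IsCycleList h l ∧ l.length = ℓ := by
  have hn : (0 : ℝ) < Fintype.card V := by exact_mod_cast Fintype.card_pos
  set n : ℝ := ((Fintype.card V : ℕ) : ℝ) with hnd
  -- the depth of the branchings: `δ n ≤ 2 ^ t ≤ 2 δ n`
  obtain ⟨t, ht1, ht2⟩ : ∃ t : ℕ, δ * n ≤ 2 ^ t ∧ (2 : ℝ) ^ t ≤ 2 * (δ * n) := by
    obtain ⟨t, ht1, ht2⟩ := exists_nat_pow_near h1 (one_lt_two (α := ℝ))
    exact ⟨t + 1, ht2.le, by rw [pow_succ]; linarith⟩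
  have hlog : 2 * t + 3 ≤ ℓ := by
    have e1 : (2 : ℝ) ^ t ≤ n := ht2.trans (by nlinarith)
    have e2 : t * Real.log 2 ≤ Real.log n := by
      rw [← Real.log_pow]; exact Real.log_le_log (by positivity) e1
    have e3 : 1 ≤ Real.log n := by
      rw [Real.le_log_iff_exp_le hn]
      linarith [Real.exp_one_lt_d9]
    have e4 := Real.log_two_gt_d9
    have e5 : (t : ℝ) * 0.6931471803 ≤ t * Real.log 2 := by gcongr
    have e6 : (2 * t + 3 : ℝ) ≤ ℓ := by linarith
    exact_mod_cast e6
  obtain ⟨m, rfl⟩ : ∃ m, ℓ = m + 2 * t + 3 := ⟨ℓ - (2 * t + 3), by omega⟩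
  have hM : (γ * n / 9 - 1 : ℝ) ≤ ⌊γ * n / 9⌋₊ := (Nat.sub_one_lt_floor _).le
  have hγ : 0 < γ := by linarith
  refine exists_cycle_of_joined_of_expanding (U := W \ W₂) (W := W₂) (d := δ * n)
    (M := ⌊γ * n / 9⌋₊) Finset.sdiff_disjoint ?_ ?_ ?_ ht1 ?_ ?_
  · rw [Finset.sdiff_union_of_subset hW₂]
    refine hdense.joinedOn hp.le hδ.le hm ?_
    have : 0 < p * n ^ 2 := by positivity
    rw [← hnd]
    nlinarith
  · intro A hA hne hAc
    have hAc' : (A.card : ℝ) ≤ γ * n / 9 :=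
      (Nat.cast_le.2 hAc).trans (Nat.floor_le (by positivity))
    refine (hsp.expansion hle hdeg (K := 8) hθ hp.le ?_ hA hne ?_).le
    · rw [← hnd]
      have : 0 < n * p := by positivity
      push_cast
      nlinarith
    · rw [← hnd]
      push_cast
      linarith
  · have e1 : (2 : ℝ) ^ t ≤ 2 * ⌊γ * n / 9⌋₊ := by
      refine ht2.trans ?_
      have : 18 * (δ * n) ≤ γ * n := by nlinarith
      linarith
    exact_mod_cast e1
  · nlinarith
  · have e1 : (m : ℝ) ≤ β * n := by
      refine le_trans ?_ hℓβ
      push_cast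
      have : (0 : ℝ) ≤ t := Nat.cast_nonneg _
      linarith
    nlinarith
end

/-! ### Cycles of all lengths in subgraphs -/

section
open scoped Classical
variable {V : Type*}

theorem IsCycleList.mem {h : SimpleGraph V} {l : List V} (hl : IsCycleList h l) {x : V}
    (hx : x ∈ l) : ∃ y, h.Adj x y := by
  obtain ⟨A, B, rfl⟩ := List.mem_iff_append.1 hx
  have hc := List.isChain_append.1 hl.1.1
  rcases B with _ | ⟨b, B⟩
  · have hA : A ≠ [] := by rintro rfl; simpa using hl.2.1
    exact ⟨_, (hc.2.2 (A.getLast hA) (List.getLast?_eq_getLast_of_ne_nil hA) x (by simp)).symm⟩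
  · exact ⟨b, (List.isChain_cons_cons.1 hc.2.1).1⟩

theorem IsCycleList.cycleGraph_isContained {G : SimpleGraph V} {H : G.Subgraph} {l : List V}
    (hl : IsCycleList H.spanningCoe l) : (SimpleGraph.cycleGraph l.length).IsContained H.coe := by
  obtain ⟨⟨hchain, hnodup⟩, hlen, hclose⟩ := hl
  have hmem : ∀ i : Fin l.length, l[i] ∈ H.verts := fun i => by
    obtain ⟨y, hy⟩ := IsCycleList.mem ⟨⟨hchain, hnodup⟩, hlen, hclose⟩ (List.getElem_mem i.2)
    exact H.edge_vert hy
  have hnext : ∀ u v : Fin l.length, (u - v).val = 1 → H.Adj l[v] l[u] := by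
    intro u v huv
    rw [Fin.sub_def] at huv
    simp only at huv
    have hu := u.2
    have hv := v.2
    by_cases h : (v : ℕ) + 1 < l.length
    · have e : (u : ℕ) = v + 1 := by
        rcases lt_or_ge (l.length - (v : ℕ) + u) l.length with h' | h'
        · rw [Nat.mod_eq_of_lt h'] at huv
          omega
        · rw [Nat.mod_eq_sub_mod h', Nat.mod_eq_of_lt (by omega)] at huv
          omega
      have := List.isChain_iff_getElem.1 hchain v h
      simp only [Fin.getElem_fin, e]
      exact this
    · have e : (u : ℕ) = 0 := by
        rcases lt_or_ge (l.length - (v : ℕ) + u) l.length with h' | h'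
        · rw [Nat.mod_eq_of_lt h'] at huv
          omega
        · rw [Nat.mod_eq_sub_mod h', Nat.mod_eq_of_lt (by omega)] at huv
          omega
      have e' : (v : ℕ) = l.length - 1 := by omega
      refine hclose l[v] ?_ l[u] ?_
      · rw [List.getLast?_eq_getElem?, Option.mem_def]
        simp only [Fin.getElem_fin, e']
        exact List.getElem?_eq_getElem _
      · rw [List.head?_eq_getElem?, Option.mem_def]
        simp only [Fin.getElem_fin, e]
        exact List.getElem?_eq_getElem _
  refine ⟨SimpleGraph.Hom.toCopy ⟨fun i => ⟨l[i], hmem i⟩, ?_⟩ ?_⟩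
  · intro u v huv
    rw [SimpleGraph.cycleGraph_adj'] at huv
    rw [SimpleGraph.Subgraph.coe_adj]
    rcases huv with h | h
    · exact (hnext u v h).symm
    · exact hnext v u h
  · intro u v huv
    have h : l[u] = l[v] := congrArg Subtype.val huv
    exact Fin.ext ((List.Nodup.getElem_inj_iff hnodup).1 h)

theorem ncard_edgeSet_graphOn (G : SimpleGraph V) (W : Finset V) :
    (graphOn G W).edgeSet.ncard = (G.induce (W : Set V)).edgeSet.ncard := by
  have h1 : graphOn G W = (G.induce (W : Set V)).map (Function.Embedding.subtype _) := by
    ext a b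
    rw [SimpleGraph.map_adj]
    constructor
    · rintro ⟨h, ha, hb⟩
      exact ⟨⟨a, ha⟩, ⟨b, hb⟩, h, rfl, rfl⟩
    · rintro ⟨⟨a, ha⟩, ⟨b, hb⟩, h, rfl, rfl⟩
      exact ⟨h, ha, hb⟩
  rw [h1, SimpleGraph.edgeSet_map]
  exact Set.ncard_image_of_injective _ (Function.Embedding.injective _)

variable [Fintype V]

theorem card_adjPairs_eq_two_mul_ncard {Γ : SimpleGraph V} {W : Finset V}
    (hΓ : ∀ a b, Γ.Adj a b → a ∈ W) : (adjPairs Γ W W).card = 2 * Γ.edgeSet.ncard := by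
  rw [← SimpleGraph.coe_edgeFinset, Set.ncard_coe_finset,
    ← SimpleGraph.sum_degrees_eq_twice_card_edges, card_adjPairs]
  have h1 : ∀ v, degIn Γ W v = Γ.degree v := by
    intro v
    rw [← SimpleGraph.card_neighborFinset_eq_degree, degIn]
    congr 1
    ext w
    simp only [Finset.mem_filter, SimpleGraph.mem_neighborFinset, and_iff_right_iff_imp]
    exact fun h => hΓ w v h.symm
  simp_rw [h1]
  refine Finset.sum_subset (Finset.subset_univ _) fun v _ hv => ?_
  rw [← SimpleGraph.card_neighborFinset_eq_degree, Finset.card_eq_zero,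
    Finset.eq_empty_iff_forall_notMem]
  intro w hw
  exact hv (hΓ v w ((SimpleGraph.mem_neighborFinset _ _ _).1 hw))

/-- The factor two is due to `AlmostInduced` counting ordered pairs. -/
theorem almostInduced_spanningCoe {G : SimpleGraph V} (H : G.Subgraph) {μ : ℝ}
    (hμ : ((G.induce H.verts).edgeSet.ncard : ℝ) - (H.edgeSet.ncard : ℝ) ≤ μ) :
    AlmostInduced G H.spanningCoe H.verts.toFinset (2 * μ) := by
  set W := H.verts.toFinset with hW
  have hWc : (W : Set V) = H.verts := Set.coe_toFinset _
  have hle : H.spanningCoe ≤ G := H.spanningCoe_le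
  have h1 : (adjPairs H.spanningCoe W W).card = 2 * H.edgeSet.ncard := by
    rw [card_adjPairs_eq_two_mul_ncard]
    · rw [SimpleGraph.Subgraph.edgeSet_spanningCoe]
    · intro a b hab
      rw [hW, Set.mem_toFinset]
      exact H.edge_vert hab
  have h2 : (adjPairs G W W).card = 2 * (G.induce H.verts).edgeSet.ncard := by
    have e : adjPairs G W W = adjPairs (graphOn G W) W W := by
      ext x
      rw [mem_adjPairs, mem_adjPairs]
      exact ⟨fun h => ⟨h.1, h.2.1, h.2.2, h.1, h.2.1⟩, fun h => ⟨h.1, h.2.1, h.2.2.1⟩⟩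
    rw [e, card_adjPairs_eq_two_mul_ncard (Γ := graphOn G W) (fun _ _ h => h.2.1),
      ncard_edgeSet_graphOn, hWc]
  have h3 := Finset.card_sdiff_add_card_eq_card (adjPairs_mono hle (le_refl W) (le_refl W))
  have h4 : ((adjPairs G W W \ adjPairs H.spanningCoe W W).card : ℝ) +
      (adjPairs H.spanningCoe W W).card = (adjPairs G W W).card := by exact_mod_cast h3
  rw [h1, h2] at h4
  push_cast at h4
  change ((adjPairs G W W \ adjPairs H.spanningCoe W W).card : ℝ) ≤ 2 * μ
  linarith

theorem subgraphMinDegree_le_degIn {G : SimpleGraph V} (H : G.Subgraph) {v : V}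
    (hv : v ∈ H.verts) : subgraphMinDegree H ≤ degIn H.spanningCoe H.verts.toFinset v := by
  unfold subgraphMinDegree
  refine (SimpleGraph.minDegree_le_degree _ ⟨v, hv⟩).trans (le_of_eq ?_)
  rw [SimpleGraph.Subgraph.coe_degree, ← SimpleGraph.Subgraph.finset_card_neighborSet_eq_degree,
    degIn]
  congr 1
  ext w
  simp only [Set.mem_toFinset, SimpleGraph.Subgraph.mem_neighborSet, Finset.mem_filter,
    SimpleGraph.Subgraph.spanningCoe_adj]
  exact ⟨fun h => ⟨H.edge_vert h.symm, h⟩, fun h => h.2⟩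

/-- Lengths of at least `β n` come from a Hamiltonian cycle of a suitable subgraph on `ℓ` vertices,
shorter ones from branchings in a subgraph on half of the vertices. -/
theorem exists_cycle_of_pseudorandom [Nonempty V] {G h : SimpleGraph V}
    {p lam α β γ γ₁ δ ε η θ κ σ : ℝ} (hp : 0 < p) (hle : h ≤ G) {W : Finset V}
    (hm : AlmostInduced G h W (ε * p * (Fintype.card V : ℝ) ^ 2))
    (hdeg : ∀ v ∈ W, lam * Fintype.card V * p ≤ degIn h W v)
    (hW : lam * Fintype.card V ≤ W.card)
    (hdense : DenseBetween G p δ) (hsp₁ : LocallySparse G p 1 γ₁) (hsp : LocallySparse G p θ γ)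
    (hedges : ((adjPairs G Finset.univ Finset.univ).card : ℝ) ≤
      12 * p * (Fintype.card V : ℝ) ^ 2)
    (hboost : DenseOnSparse G p η κ boosters)
    (hlam : 8 * β ≤ lam) (c1 : 2 * γ₁ + ε + 2 * α < β ^ 2 / 64) (c2 : (α - γ₁ / 4) * δ + ε < 0)
    (c3 : α ≤ γ₁ / 4) (c4 : 2 * θ < lam - α) (hα : 0 ≤ α) (hδγ₁ : δ ≤ γ₁)
    (hδ : 0 < δ) (hδ1 : 2 * δ ≤ 1) (hδγ : 18 * δ ≤ γ) (hδβ : 5 * δ < β) (hε : ε ≤ δ ^ 2 / 8)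
    (hεκ : ε < κ / 4) (hκ : 200 * κ ≤ β ^ 2) (hθ : 0 ≤ θ) (hσα : σ ≤ α)
    (hθσ : 6 * θ < σ) (hση : 8 * σ ≤ η) (hθα : 18 * θ < α)
    (h1 : 1 ≤ σ * (p * Fintype.card V))
    (h2 : 8 ≤ η * (p * Fintype.card V)) (h3 : 1156 ≤ η * δ ^ 2 * (p * Fintype.card V))
    (h4 : 8 ≤ β * Fintype.card V) (h5 : 1 ≤ δ * Fintype.card V)
    (h6 : 3 ≤ (Fintype.card V : ℝ)) {ℓ : ℕ} (hℓ : 6 * Real.log (Fintype.card V) ≤ ℓ)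
    (hℓW : ℓ ≤ W.card) : ∃ l, IsCycleList h l ∧ l.length = ℓ := by
  have hn : (0 : ℝ) < Fintype.card V := by exact_mod_cast Fintype.card_pos
  have hsub : ∀ m : ℕ, 2 ≤ m → β * Fintype.card V ≤ m → m ≤ W.card → ∃ W' ⊆ W, W'.card = m ∧
      ∀ v ∈ W', α * Fintype.card V * p ≤ degIn h W' v := by
    intro m hm2 hmβ hmW
    set n : ℝ := ((Fintype.card V : ℕ) : ℝ)
    have hpn : 0 < p * n ^ 2 := by positivity
    refine exists_subset_minDegree hp.le hle hm hdeg hdense hsp₁ hsp hδ.le (by linarith) hδγ₁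
      (by linarith) (by positivity) ?_ ?_ ?_ ?_ hm2 hmβ hmW
    · have := mul_lt_mul_of_pos_right c1 hpn
      linarith
    · have := mul_lt_mul_of_pos_right c2 hpn
      linarith
    · have : α * (n * p) ≤ γ₁ / 4 * (n * p) := by gcongr
      linarith
    · have : 2 * θ * (n * p) < (lam - α) * (n * p) := by gcongr
      linarith
  have hlamn : 8 * β * Fintype.card V ≤ lam * Fintype.card V := by gcongr
  by_cases hβ : β * Fintype.card V ≤ ℓ
  · have hℓ2 : 2 ≤ ℓ := by
      have : (2 : ℝ) ≤ ℓ := by linarith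
      exact_mod_cast this
    obtain ⟨W', hW', hW'c, hW'd⟩ := hsub ℓ hℓ2 hβ hℓW
    obtain ⟨l, hl, hlW⟩ := exists_hamiltonian_cycle_of_pseudorandom (h := graphOn h W') (W := W')
      (α := α) (β := β) hp ((graphOn_le h W').trans hle) (fun a b hab => hab.2.1)
      (hm.graphOn hW') (fun v hv => by rw [degIn_graphOn h hv]; exact hW'd v hv)
      (by rw [hW'c]; exact hβ) hdense hsp hedges hboost hδ (by linarith) (by linarith) hδβ hε hεκ
      hκ hθ hσα hθσ hση h1 h2 h3 h4
    refine ⟨l, ⟨hl.1.mono (graphOn_le _ _), hl.2.1, fun a ha b hb => (hl.2.2 a ha b hb).1⟩, ?_⟩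
    rw [← hW'c, ← hlW, List.toFinset_card_of_nodup hl.1.2]
  · have hhalf : (W.card : ℝ) ≤ 2 * (W.card / 2 : ℕ) + 1 := by
      have : W.card ≤ 2 * (W.card / 2) + 1 := by omega
      exact_mod_cast this
    have hhalf' : 2 * β * Fintype.card V ≤ (W.card / 2 : ℕ) := by linarith
    have hc2 : 2 ≤ W.card / 2 := by
      have : (2 : ℝ) ≤ (W.card / 2 : ℕ) := by linarith
      exact_mod_cast this
    obtain ⟨W₂, hW₂, hW₂c, hW₂d⟩ := hsub (W.card / 2) hc2 (by linarith) (Nat.div_le_self _ _)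
    have hUc : ((W.card / 2 : ℕ) : ℝ) ≤ (W \ W₂).card := by
      have : W.card / 2 ≤ (W \ W₂).card := by
        rw [Finset.card_sdiff_of_subset hW₂, hW₂c]; omega
      exact_mod_cast this
    exact exists_short_cycle_of_pseudorandom hp hle hm hW₂ hW₂d (β := β) (by rw [hW₂c]; linarith)
      (hhalf'.trans hUc) hdense hsp hδ hδγ (by linarith) hδ1
      (by have : 0 < δ ^ 2 := by positivity
          linarith) hθ hθα h5 (by linarith) h6 hℓ (not_le.1 hβ).le
end

/-! ### Choice of constants and conclusion -/

section
open scoped Classical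

/-- Every subgraph on more than `lam n` vertices with minimum degree at least `lam n p` that misses
at most `ε p n ^ 2` of the edges induced on its vertices contains all cycles of length at least
`B log n`. -/
def HasAllCycles {V : Type*} [Fintype V] (G : SimpleGraph V) (p lam B ε : ℝ) : Prop :=
  ∀ H : G.Subgraph, lam * (Fintype.card V : ℝ) < (H.verts.ncard : ℝ) →
    lam * (Fintype.card V : ℝ) * p ≤ (subgraphMinDegree H : ℝ) →
    ((G.induce H.verts).edgeSet.ncard : ℝ) - (H.edgeSet.ncard : ℝ) ≤
      ε * p * (Fintype.card V : ℝ) ^ 2 →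
    ∀ ℓ : ℕ, B * Real.log (Fintype.card V : ℝ) ≤ (ℓ : ℝ) → ℓ ≤ H.verts.ncard →
      (SimpleGraph.cycleGraph ℓ).IsContained H.coe

theorem HasAllCycles.mono_lam {V : Type*} [Fintype V] {G : SimpleGraph V} {p lam lam' B ε : ℝ}
    (h : HasAllCycles G p lam B ε) (hp : 0 ≤ p) (hlam : lam ≤ lam') :
    HasAllCycles G p lam' B ε := by
  intro H h1 h2
  exact h H (lt_of_le_of_lt (by gcongr) h1) (le_trans (by gcongr) h2)

/-- A choice of constants: `1 ≥ lam ≫ β ≫ γ₁ ≫ α`, then `β ≫ κ ≫ η`, then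
`α, η ≫ σ ≫ θ ≫ γ ≫ δ ≫ ε`. -/
theorem exists_constants {lam : ℝ} (hlam : 0 < lam) (hlam1 : lam ≤ 1) :
    ∃ α β γ γ₁ δ ε η θ κ σ : ℝ, 0 < β ∧ 0 < κ ∧ κ ≤ 1 ∧ 0 < η ∧ 0 < σ ∧ 0 < θ ∧ θ ≤ 1 ∧ 0 < ε ∧
      γ = θ ^ 2 / 9 ∧ η = κ ^ 2 / 128 ∧ γ₁ ≤ 1 ^ 2 / 9 ∧
      8 * β ≤ lam ∧ 2 * γ₁ + ε + 2 * α < β ^ 2 / 64 ∧ (α - γ₁ / 4) * δ + ε < 0 ∧ α ≤ γ₁ / 4 ∧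
      2 * θ < lam - α ∧ 0 ≤ α ∧ δ ≤ γ₁ ∧ 0 < δ ∧ 2 * δ ≤ 1 ∧ 18 * δ ≤ γ ∧ 5 * δ < β ∧
      ε ≤ δ ^ 2 / 8 ∧ ε < κ / 4 ∧ 200 * κ ≤ β ^ 2 ∧ σ ≤ α ∧ 6 * θ < σ ∧ 8 * σ ≤ η ∧
      18 * θ < α := by
  obtain ⟨β, hβ⟩ : ∃ β, β = lam / 8 := ⟨_, rfl⟩
  have hβ0 : 0 < β := by rw [hβ]; positivity
  have hβ1 : β ≤ 1 / 8 := by linarith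
  have hβ2 : β ^ 2 ≤ β / 8 := by nlinarith
  obtain ⟨γ₁, hγ₁⟩ : ∃ γ₁, γ₁ = β ^ 2 / 512 := ⟨_, rfl⟩
  have hγ₁0 : 0 < γ₁ := by rw [hγ₁]; positivity
  obtain ⟨α, hα⟩ : ∃ α, α = γ₁ / 8 := ⟨_, rfl⟩
  have hα0 : 0 < α := by rw [hα]; positivity
  obtain ⟨κ, hκ⟩ : ∃ κ, κ = β ^ 2 / 200 := ⟨_, rfl⟩
  have hκ0 : 0 < κ := by rw [hκ]; positivity
  obtain ⟨η, hη⟩ : ∃ η, η = κ ^ 2 / 128 := ⟨_, rfl⟩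
  have hη0 : 0 < η := by rw [hη]; positivity
  have hη1 : η ≤ 1 / 128 := by
    have : κ ^ 2 ≤ 1 := pow_le_one₀ hκ0.le (by linarith)
    linarith
  obtain ⟨σ, hσ⟩ : ∃ σ, σ = η * α / 8 := ⟨_, rfl⟩
  have hσ0 : 0 < σ := by rw [hσ]; positivity
  have hσα : σ ≤ α / 1024 := by
    have : η * α ≤ 1 / 128 * α := by gcongr
    linarith
  have hση : 8 * σ ≤ η := by
    have : η * α ≤ η * 1 := by gcongr; linarith
    linarith
  obtain ⟨θ, hθ⟩ : ∃ θ, θ = σ / 8 := ⟨_, rfl⟩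
  have hθ0 : 0 < θ := by rw [hθ]; positivity
  have hθ1 : θ ≤ 1 := by linarith
  obtain ⟨γ, hγ⟩ : ∃ γ, γ = θ ^ 2 / 9 := ⟨_, rfl⟩
  have hγ0 : 0 < γ := by rw [hγ]; positivity
  have hγle : γ ≤ 1 := by
    have : θ ^ 2 ≤ 1 := pow_le_one₀ hθ0.le hθ1
    linarith
  obtain ⟨δ, hδ⟩ : ∃ δ, δ = γ * γ₁ / 100 := ⟨_, rfl⟩
  have hδ0 : 0 < δ := by rw [hδ]; positivity
  have hδγ : δ ≤ γ / 100 := by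
    have : γ * γ₁ ≤ γ * 1 := by gcongr; linarith
    linarith
  have hδγ₁ : δ ≤ γ₁ / 100 := by
    have : γ * γ₁ ≤ 1 * γ₁ := by gcongr
    linarith
  have hδ1 : δ ≤ 1 := by linarith
  obtain ⟨ε, hε⟩ : ∃ ε, ε = δ ^ 2 * κ * γ₁ / 100 := ⟨_, rfl⟩
  have hε0 : 0 < ε := by rw [hε]; positivity
  have hκ1 : κ ≤ 1 := by linarith
  have hγ₁1 : γ₁ ≤ 1 := by linarith
  have hδ2 : δ ^ 2 ≤ δ := by nlinarith
  have hε1 : ε ≤ δ ^ 2 / 100 := by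
    have : δ ^ 2 * κ * γ₁ ≤ δ ^ 2 * 1 * 1 := by gcongr
    linarith
  have hε2 : ε ≤ κ / 100 := by
    have : δ ^ 2 * κ * γ₁ ≤ 1 * κ * 1 := by gcongr; linarith
    linarith
  have hε3 : ε ≤ δ * γ₁ / 100 := by
    have : δ ^ 2 * κ * γ₁ ≤ δ * 1 * γ₁ := by gcongr
    linarith
  have hε4 : ε ≤ γ₁ / 100 := by
    have : δ * γ₁ ≤ 1 * γ₁ := by gcongr
    linarith
  have hδ0' : 0 < δ ^ 2 := by positivity
  refine ⟨α, β, γ, γ₁, δ, ε, η, θ, κ, σ, hβ0, hκ0, hκ1, hη0, hσ0, hθ0, hθ1, hε0, hγ, hη, by linarith,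
    by linarith, by linarith, ?_, by linarith, by linarith, hα0.le, by linarith, hδ0, by linarith,
    by linarith, by linarith, by linarith, by linarith, by linarith, by linarith, by linarith, hση,
    by linarith⟩
  have h1 : (α - γ₁ / 4) * δ = -(δ * γ₁ / 8) := by rw [hα]; ring
  have h2 : 0 < δ * γ₁ := by positivity
  linarith

theorem exists_measure_not_hasAllCycles_le {lam : ℝ} (hlam : 0 < lam) (hlam1 : lam ≤ 1) :
    ∃ C ε n₀ : ℝ, 0 < C ∧ 0 < ε ∧ ∀ (V : Type) [Fintype V] [Nonempty V] (p : unitInterval),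
      C ≤ p * Fintype.card V → n₀ ≤ Fintype.card V →
      SimpleGraph.binomialRandom V p {G | ¬ HasAllCycles G p lam 6 ε} ≤
        5 * ENNReal.ofReal (1 / Fintype.card V) := by
  obtain ⟨α, β, γ, γ₁, δ, ε, η, θ, κ, σ, hβ0, hκ0, hκ1, hη0, hσ0, hθ0, hθ1, hε0, hγ, hη, hγ₁, b1, b2,
    b3, b4, b5, b6, b7, hδ0, b8, b9, b10, b11, b12, b13, b14, b15, b16, b17⟩ :=
    exists_constants hlam hlam1
  set C : ℝ := 12 / δ ^ 2 + 8 + 8 / θ + 16 / κ + 1 / σ + 8 / η + 1156 / (η * δ ^ 2) with hC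
  refine ⟨C, ε / 2, 8 / β + 1 / δ + 3, by positivity, by positivity, ?_⟩
  intro V _ _ p hCp hn₀
  have hn : (0 : ℝ) < Fintype.card V := by exact_mod_cast Fintype.card_pos
  have q1 : (0 : ℝ) < 12 / δ ^ 2 := by positivity
  have q2 : 0 < 8 / θ := by positivity
  have q3 : 0 < 16 / κ := by positivity
  have q4 : 0 < 1 / σ := by positivity
  have q5 : 0 < 8 / η := by positivity
  have q6 : 0 < 1156 / (η * δ ^ 2) := by positivity
  have q7 : 0 < 8 / β := by positivity
  have q8 : 0 < 1 / δ := by positivity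
  have hp : (0 : ℝ) < p := by
    have : 0 < (p : ℝ) * Fintype.card V := by linarith
    exact pos_of_mul_pos_left this hn.le
  have w1 : 1 ≤ σ * ((p : ℝ) * Fintype.card V) := by
    rw [← div_le_iff₀' hσ0]; linarith
  have w2 : 8 ≤ η * ((p : ℝ) * Fintype.card V) := by
    rw [← div_le_iff₀' hη0]; linarith
  have w3 : 1156 ≤ η * δ ^ 2 * ((p : ℝ) * Fintype.card V) := by
    rw [← div_le_iff₀' (by positivity)]; linarith
  have w4 : 8 ≤ β * (Fintype.card V : ℝ) := by
    rw [← div_le_iff₀' hβ0]; linarith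
  have w5 : 1 ≤ δ * (Fintype.card V : ℝ) := by
    rw [← div_le_iff₀' hδ0]; linarith
  have w6 : (3 : ℝ) ≤ Fintype.card V := by linarith
  have m1 := measure_not_denseBetween_le (V := V) p hδ0 (by linarith)
  have m2 := measure_not_locallySparse_le (V := V) p one_pos le_rfl (by linarith)
  have m3 := measure_not_locallySparse_le (V := V) p hθ0 hθ1 (by linarith)
  have m4 := measure_adjPairs_univ_gt_le (V := V) p (by linarith)
  have m5 := measure_not_denseOnSparse_le (V := V) p hκ0 hκ1 (by linarith) boosters
    boosters_subset disjoint_edgeFinset_boosters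
  rw [← hγ] at m3
  rw [← hη] at m5
  have hsub : {G : SimpleGraph V | ¬ HasAllCycles G p lam 6 (ε / 2)} ⊆
      {G | ¬ DenseBetween G p δ} ∪ ({G | ¬ LocallySparse G p 1 (1 ^ 2 / 9)} ∪
      ({G | ¬ LocallySparse G p θ γ} ∪ ({G | 12 * (p : ℝ) * (Fintype.card V : ℝ) ^ 2 <
      ((adjPairs G Finset.univ Finset.univ).card : ℝ)} ∪
      {G | ¬ DenseOnSparse G p η κ boosters}))) := by
    intro G hG
    by_contra hgood
    simp only [Set.mem_union, Set.mem_ofPred_eq, not_or, not_not, not_lt] at hgood hG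
    obtain ⟨g1, g2, g3, g4, g5⟩ := hgood
    refine hG fun H hH1 hH2 hH3 ℓ hℓ hℓW => ?_
    have hWc : H.verts.toFinset.card = H.verts.ncard := (Set.ncard_eq_toFinset_card' _).symm
    have hm := almostInduced_spanningCoe H hH3
    rw [show 2 * (ε / 2 * (p : ℝ) * (Fintype.card V : ℝ) ^ 2) =
      ε * p * (Fintype.card V : ℝ) ^ 2 by ring] at hm
    obtain ⟨l, hl, rfl⟩ := exists_cycle_of_pseudorandom (h := H.spanningCoe) (W := H.verts.toFinset)
      (α := α) (β := β) (σ := σ) (ε := ε) (ℓ := ℓ) hp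
      H.spanningCoe_le hm
      (fun v hv => hH2.trans (by
        exact_mod_cast subgraphMinDegree_le_degIn H (Set.mem_toFinset.1 hv)))
      (by rw [hWc]; exact hH1.le) g1 (g2.mono hγ₁) g3 g4 g5
      b1 b2 b3 b4 b5 b6 b7 hδ0 b8 b9 b10 b11 b12 b13 hθ0.le b14 b15 b16 b17
      w1 w2 w3 w4 w5 w6
      hℓ (by rw [hWc]; exact hℓW)
    exact hl.cycleGraph_isContained
  refine (measure_mono hsub).trans ?_
  set x := ENNReal.ofReal (1 / Fintype.card V)
  calc _ ≤ x + (x + (x + (x + x))) :=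
        (measure_union_le _ _).trans (add_le_add m1 ((measure_union_le _ _).trans (add_le_add m2
          ((measure_union_le _ _).trans (add_le_add m3 ((measure_union_le _ _).trans
            (add_le_add m4 m5)))))))
    _ = 5 * x := by ring
end

theorem mainTheorem3 (lam : ℝ) (hlam : 0 < lam) :
    ∃ B C ε : ℝ, 0 < B ∧ 0 < C ∧ 0 < ε ∧
      ∀ p : ℕ → unitInterval, (∀ᶠ n : ℕ in atTop, C / (n : ℝ) ≤ (p n : ℝ)) →
        Tendsto
          (fun n : ℕ => SimpleGraph.binomialRandom (Fin n) (p n)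
            {G : SimpleGraph (Fin n) | ∀ H : G.Subgraph,
              lam * (n : ℝ) < (H.verts.ncard : ℝ) →
              lam * (n : ℝ) * (p n : ℝ) ≤ (subgraphMinDegree H : ℝ) →
              ((G.induce H.verts).edgeSet.ncard : ℝ) - (H.edgeSet.ncard : ℝ)
                ≤ ε * (p n : ℝ) * (n : ℝ) ^ 2 →
              ∀ ℓ : ℕ, B * Real.log (n : ℝ) ≤ (ℓ : ℝ) → ℓ ≤ H.verts.ncard →
                (SimpleGraph.cycleGraph ℓ).IsContained H.coe})
          atTop (𝓝 1) := by
  obtain ⟨C, ε, n₀, hC, hε, hbad⟩ := exists_measure_not_hasAllCycles_le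
    (lam := min lam 1) (lt_min hlam one_pos) (min_le_right _ _)
  refine ⟨6, C, ε, by norm_num, hC, hε, fun p hp => ?_⟩
  have hlim : Tendsto (fun n : ℕ => 1 - 5 * ENNReal.ofReal (1 / (n : ℝ))) atTop (𝓝 1) := by
    have h1 : Tendsto (fun n : ℕ => ENNReal.ofReal (1 / (n : ℝ))) atTop (𝓝 0) := by
      have := ENNReal.tendsto_ofReal (tendsto_one_div_atTop_nhds_zero_nat (𝕜 := ℝ))
      simpa using this
    have h2 := ENNReal.Tendsto.const_mul (a := 5) h1 (Or.inr (by norm_num))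
    have h3 := ENNReal.Tendsto.sub (tendsto_const_nhds (x := (1 : ENNReal)) (f := atTop)) h2
      (Or.inl (by norm_num))
    simpa using h3
  refine tendsto_of_tendsto_of_tendsto_of_le_of_le' hlim tendsto_const_nhds ?_
    (Eventually.of_forall fun n => prob_le_one)
  filter_upwards [hp, eventually_ge_atTop 1, eventually_ge_atTop ⌈n₀⌉₊] with n hpn hn1 hn0
  have hn : (0 : ℝ) < n := by exact_mod_cast hn1
  have : Nonempty (Fin n) := ⟨⟨0, hn1⟩⟩
  have h1 := hbad (Fin n) (p n) (by rw [Fintype.card_fin]; rwa [div_le_iff₀ hn] at hpn)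
    (by rw [Fintype.card_fin]; exact Nat.ceil_le.1 hn0)
  rw [Fintype.card_fin] at h1
  rw [tsub_le_iff_right]
  set S := {G : SimpleGraph (Fin n) | HasAllCycles G (p n) (min lam 1) 6 ε} with hS
  calc (1 : ENNReal) = SimpleGraph.binomialRandom (Fin n) (p n) Set.univ := measure_univ.symm
    _ ≤ SimpleGraph.binomialRandom (Fin n) (p n) (S ∪ Sᶜ) := by rw [Set.union_compl_self]
    _ ≤ _ := measure_union_le _ _
    _ ≤ _ := by
        gcongr
        · intro G hG
          have h2 := HasAllCycles.mono_lam hG (p n).2.1 (min_le_left lam 1)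
          simp only [HasAllCycles, Fintype.card_fin] at h2
          exact h2
        · exact h1
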